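/- Let $\mathrm{Sch}_{\mathbb Z}$ be the category of $\mathbb Z$-schemes of finite presentation. A chain ring is a nonzero commutative ring whose set of ideals is totally ordered by inclusion. For a class $\mathcal G$ of families of morphisms with common target in $\mathrm{Sch}_{\mathbb Z}$, the composites of pullbacks of families in $\mathcal G$ form the smallest class of families that contains every pullback $\{E_i\times_S S'\to S'\}$ of a family $\{E_i\to S\}$ in $\mathcal G$ along a morphism $S'\to S$ of $\mathrm{Sch}_{\mathbb Z}$, and that contains $\{V_{ij}\to V_i\to S\}_{i,j}$ whenever it contains $\{V_i\to S\}_i$ and $\{V_{ij}\to V_i\}_j$ for every $i$. A family $\{Y_i\to X\}_{i\in I}$ is refinable by $\{V_j\to X\}_{j\in J}$ if every $V_j\to X$ factors through some $Y_i\to X$. A Zariski covering is a jointly surjective family of open immersions (the empty family is a Zariski covering of the empty scheme). For a closed subscheme $Z\subseteq X$, $\mathrm{Bl}_Z X\to X$ denotes the blowup of $X$ in $Z$. **Proposition 4.3 (= Proposition 1.2).** Let $\mathcal U=\{Y_i\to X\}_{i\in I}$ be a family of morphisms in $\mathrm{Sch}_{\mathbb Z}$. The following are equivalent. 1. $\mathcal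 U$ is a covering for the chain topology, i.e. for every chain ring $R$ the map $\coprod_{i\in I}\hom(\mathrm{Spec}(R),Y_i)\to\hom(\mathrm{Spec}(R),X)$ is surjective. 2. $\mathcal U$ is refinable by a composite of pullbacks of families of the form: (a) Zariski coverings; (b) smooth blowups, i.e. families $\{Z\to S,\ \mathrm{Bl}_Z S\to S\}$ where $S\in\mathrm{Sch}_{\mathbb Z}$ and $Z\subseteq S$ is a closed subscheme, with $Z$ and $S$ smooth over $\mathbb Z$. 3. $\mathcal U$ is refinable by a composite of pullbacks of families of the form: (a) Zariski coverings; (b) the families $\{\{0\}\to\mathbb A^n,\ \mathrm{Bl}_{\{0\}}\mathbb A^n\to\mathbb A^n\}$ for $n\ge 2$, where $\mathbb A^n=\mathrm{Spec}\,\mathbb Z[x_1,\dots,x_n]$ and $\{0\}\cong\mathrm{Spec}\,\mathbb Z$ is the closed subscheme defined by $(x_1,\dots,x_n)$. 4. $\mathcal U$ is refinable by a composite of pullbacks of families of the form: (a) Zariski coverings; (b) the family $\{\{0\}\to\mathbb A^2,\ \mathrm{Bl}_{\{0\}}\mathbb A^2\to\mathbb A^2\}$. -/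

import Mathlib

open CategoryTheory AlgebraicGeometry

universe u v w

/-! ## Families of morphisms with a common target

`PreZeroHypercover X` is Mathlib's type of indexed families `{Y i ⟶ X}` (index type `I₀`, objects
`X i`, morphisms `f i`); `E.bind F` is the composite family, and `V.Hom U` is the type of maps
exhibiting `V` as a refinement of `U`. -/

section Families

variable {C : Type u} [Category.{v} C]

/-- The two-element family `{Z ⟶ X, B ⟶ X}`. -/
def pairFamily {Z B X : C} (i : Z ⟶ X) (b : B ⟶ X) : PreZeroHypercover.{0} X where
  I₀ := Bool
  X := fun j => Bool.rec Z B j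
  f := fun j => Bool.rec i b j

/-- `CompositeOfPullbacks G E`: the family `E` is an iterated (well-founded) composite of
pullbacks of families belonging to the class `G`. -/
inductive CompositeOfPullbacks (G : ∀ X : C, PreZeroHypercover.{0} X → Prop) :
    ∀ X : C, PreZeroHypercover.{0} X → Prop
  /-- A pullback of a family `E` in `G` along a morphism `g : X' ⟶ X`. -/
  | pullback {X X' : C} (g : X' ⟶ X) (E : PreZeroHypercover.{0} X) (hE : G X E)
      (Y : E.I₀ → C) (p : ∀ i, Y i ⟶ X') (q : ∀ i, Y i ⟶ E.X i)
      (h : ∀ i, IsPullback (q i) (p i) (E.f i) g) :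
      CompositeOfPullbacks G X' ⟨E.I₀, Y, p⟩
  /-- The composite `{V i j ⟶ E.X i ⟶ X}` of a family `E` with a family over each `E.X i`. -/
  | comp {X : C} (E : PreZeroHypercover.{0} X) (F : ∀ i, PreZeroHypercover.{0} (E.X i))
      (hE : CompositeOfPullbacks G X E) (hF : ∀ i, CompositeOfPullbacks G (E.X i) (F i)) :
      CompositeOfPullbacks G X (E.bind F)

/-- The family `U` is refinable by a composite of pullbacks of families in `G`: there is such a
composite `V`, each member of which factors over `X` through some member of `U`. -/
def IsRefinableBy (G : ∀ X : C, PreZeroHypercover.{0} X → Prop) {X : C}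
    (U : PreZeroHypercover.{w} X) : Prop :=
  ∃ V : PreZeroHypercover.{0} X, CompositeOfPullbacks G X V ∧ Nonempty (V.Hom U)

end Families

/-! ## The category of `ℤ`-schemes of finite presentation -/

/-- Morphisms of finite presentation: locally of finite presentation, quasi-compact and
quasi-separated. -/
def finitePresentationMorphisms : MorphismProperty Scheme.{0} := fun _ _ f =>
  LocallyOfFinitePresentation f ∧ QuasiCompact f ∧ QuasiSeparated f

/-- The category `Sch_ℤ` of `ℤ`-schemes of finite presentation, with all `ℤ`-morphisms. The
underlying scheme of `X : SchZ` is `X.left`, its structure morphism is `X.hom`. -/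
abbrev SchZ : Type 1 :=
  finitePresentationMorphisms.Over ⊤ (Spec (CommRingCat.of ℤ))

/-! ## Chain rings and the chain topology -/

/-- A chain ring: a nonzero commutative ring whose ideals are totally ordered by inclusion. -/
structure IsChainRing (R : Type u) [CommRing R] : Prop where
  nontrivial : Nontrivial R
  ideal_total : ∀ I J : Ideal R, I ≤ J ∨ J ≤ I

/-- `U = {Y i ⟶ X}` is a covering for the chain topology: for every chain ring `R`, every
`Spec R ⟶ X` factors through some `Y i`. -/
def IsChainCovering {X : SchZ} (U : PreZeroHypercover.{w} X) : Prop :=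
  ∀ (R : Type) [CommRing R], IsChainRing R →
    ∀ x : Spec (CommRingCat.of R) ⟶ X.left,
      ∃ (i : U.I₀) (y : Spec (CommRingCat.of R) ⟶ (U.X i).left), y ≫ (U.f i).left = x

/-! ## Zariski coverings -/

/-- Zariski coverings: jointly surjective families of open immersions. -/
def IsZariskiCovering (X : SchZ) (E : PreZeroHypercover.{0} X) : Prop :=
  (∀ i, IsOpenImmersion (E.f i).left) ∧ ∀ x : X.left, ∃ i, x ∈ Set.range (E.f i).left

/-! ## Blowups -/

/-- The ideal sheaf `I` is invertible, i.e. it cuts out an effective Cartier divisor: locally it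
is generated by a single nonzerodivisor. -/
def IsEffectiveCartier {T : Scheme.{0}} (I : T.IdealSheafData) : Prop :=
  ∀ x : T, ∃ U : T.affineOpens, x ∈ U.1 ∧ ∃ f ∈ nonZeroDivisors Γ(T, U.1),
    I.ideal U = Ideal.span {f}

/-- `b : B ⟶ X` is the blowup of `X` in the closed subscheme `i : Z ⟶ X`: the inverse image of `Z`
in `B` is an effective Cartier divisor, and `b` is universal (terminal) among all morphisms of
schemes `T ⟶ X` with this property. -/
structure IsBlowup {Z X B : Scheme.{0}} (i : Z ⟶ X) (b : B ⟶ X) : Prop where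
  closedImmersion : IsClosedImmersion i
  cartier : IsEffectiveCartier (i.ker.comap b)
  universal : ∀ (T : Scheme.{0}) (t : T ⟶ X), IsEffectiveCartier (i.ker.comap t) →
    ∃! g : T ⟶ B, g ≫ b = t

/-- The smooth blowup families `{Z ⟶ X, Bl_Z X ⟶ X}`, for `Z` a closed subscheme of `X`, with `Z`
and `X` smooth over `ℤ`. -/
inductive IsSmoothBlowupFamily : ∀ X : SchZ, PreZeroHypercover.{0} X → Prop
  | mk {Z X B : SchZ} (i : Z ⟶ X) (b : B ⟶ X) (hZ : Smooth Z.hom) (hX : Smooth X.hom)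
      (h : IsBlowup i.left b.left) : IsSmoothBlowupFamily X (pairFamily i b)

/-! ## Affine space and its origin -/

theorem finitePresentationMorphisms_specMap {R : Type} [CommRing R] (φ : ℤ →+* R)
    (hφ : φ.FinitePresentation) :
    finitePresentationMorphisms (Spec.map (CommRingCat.ofHom φ)) := by
  refine ⟨?_, inferInstance, inferInstance⟩
  rw [HasRingHomProperty.Spec_iff (P := @LocallyOfFinitePresentation)]
  exact hφ

/-- `Spec ℤ` as an object of `SchZ`. -/
noncomputable def pointZ : SchZ :=
  MorphismProperty.Over.mk ⊤ (Spec.map (CommRingCat.ofHom (RingHom.id ℤ)))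
    (finitePresentationMorphisms_specMap _ (RingHom.FinitePresentation.id ℤ))

/-- Affine space `𝔸ⁿ = Spec ℤ[x₁, …, xₙ]` as an object of `SchZ`. -/
noncomputable def affineSpaceZ (n : ℕ) : SchZ :=
  MorphismProperty.Over.mk ⊤
    (Spec.map (CommRingCat.ofHom (algebraMap ℤ (MvPolynomial (Fin n) ℤ))))
    (finitePresentationMorphisms_specMap _
      (RingHom.finitePresentation_algebraMap.mpr inferInstance))

/-- The inclusion `{0} ⟶ 𝔸ⁿ` of the origin, i.e. the closed subscheme `Spec ℤ` defined by the ideal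
`(x₁, …, xₙ)`. -/
noncomputable def originZ (n : ℕ) : pointZ ⟶ affineSpaceZ n :=
  MorphismProperty.Over.homMk
    (Spec.map (CommRingCat.ofHom (MvPolynomial.constantCoeff (R := ℤ) (σ := Fin n))))
    (specZIsTerminal.hom_ext _ _)

/-- The families `{{0} ⟶ 𝔸ⁿ, Bl_{0} 𝔸ⁿ ⟶ 𝔸ⁿ}`, for a fixed `n`. -/
inductive IsOriginBlowupFamily (n : ℕ) : ∀ X : SchZ, PreZeroHypercover.{0} X → Prop
  | mk {B : SchZ} (b : B ⟶ affineSpaceZ n) (h : IsBlowup (originZ n).left b.left) :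
      IsOriginBlowupFamily n (affineSpaceZ n) (pairFamily (originZ n) b)

/-! In a chain ring any two elements are comparable for divisibility. An `R`-point `(a, b)` of the
plane with `b = a * t` lifts to the chart of the blowup with coordinates `(a, t)`; conversely, on
each chart of the blowup one coordinate divides the other, and at the origin both vanish. So the
origin blowup family is a chain covering, and it also suffices to force divisibility.

A chain covering is refinable by origin blowups of the plane and Zariski coverings: otherwise take
`Spec A ⟶ X` with `A` of finite type, along which `U` is not refinable. For `a, b : A`, pull the
plane family back along `(a, b)`; failure persists on some affine piece `Spec A'`, where one of `a,
b` divides the other (`exists_step`). As the rings are countable, bookkeeping treats every pair at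
every stage (`exists_tower`), and the colimit is a chain ring. Its point of `X` lifts to a member of
`U`, and by finite presentation the lift already exists at a finite stage: a contradiction. This
needs an explicit blowup of the plane, glued from two charts (`IsPlaneBlowupAtlas.isBlowup`).

Smooth blowups are chain coverings by comparison with affine space. Locally the centre is cut out by
a sequence `f` for which `k[X] → L`, `X i ↦ f i`, is flat, by the Jacobian criterion
(`exists_flat_aeval_of_formallySmooth_quotient`). In a chain ring some `f i` divides all the others,
so the point factors through the pushout of a chart of the blowup of affine space. Flatness keeps
the equation of the exceptional divisor a nonzerodivisor there, and the universal property of the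
blowup gives the lift. The remaining implications are inclusions between the generating classes. -/

open CategoryTheory.Limits

/-! ### Schemes of finite presentation over `ℤ` and their fibre products -/

section SchZ

/-- Since `ℤ` is Noetherian, finite type already gives finite presentation and quasi-separatedness.
-/
theorem finitePresentationMorphisms_iff {X : Scheme.{0}} (f : X ⟶ Spec (CommRingCat.of ℤ)) :
    finitePresentationMorphisms f ↔ LocallyOfFiniteType f ∧ CompactSpace X := by
  constructor
  · rintro ⟨h₁, h₂, -⟩
    exact ⟨inferInstance, (quasiCompact_iff_compactSpace f).mp h₂⟩
  · rintro ⟨h₁, h₂⟩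
    have : IsLocallyNoetherian X := LocallyOfFiniteType.isLocallyNoetherian f
    refine ⟨?_, (quasiCompact_iff_compactSpace f).mpr h₂,
      (quasiSeparated_iff_quasiSeparatedSpace f).mpr inferInstance⟩
    exact (LocallyOfFinitePresentation.iff_locallyOfFiniteType).mpr h₁

namespace SchZ

instance (X : SchZ) : LocallyOfFinitePresentation X.hom := X.prop.1
instance (X : SchZ) : QuasiCompact X.hom := X.prop.2.1
instance (X : SchZ) : QuasiSeparated X.hom := X.prop.2.2
instance (X : SchZ) : CompactSpace X.left := ((finitePresentationMorphisms_iff _).mp X.prop).2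
instance (X : SchZ) : IsLocallyNoetherian X.left :=
  LocallyOfFiniteType.isLocallyNoetherian (Y := Spec (CommRingCat.of ℤ)) X.hom

/-- A morphism of the underlying schemes, as a morphism of `SchZ`. -/
noncomputable def homMk {X Y : SchZ} (f : X.left ⟶ Y.left) : X ⟶ Y :=
  MorphismProperty.Over.homMk f (specZIsTerminal.hom_ext _ _)

theorem hom_ext {X Y : SchZ} {f g : X ⟶ Y} (h : f.left = g.left) : f = g :=
  MorphismProperty.Over.Hom.ext h

theorem w_left {X Y : SchZ} (f : X ⟶ Y) : f.left ≫ Y.hom = X.hom :=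
  specZIsTerminal.hom_ext _ _

/-- A scheme of finite presentation over `ℤ`, as an object of `SchZ`. -/
noncomputable def mk' (X : Scheme.{0}) (h : finitePresentationMorphisms (specZIsTerminal.from X)) :
    SchZ :=
  MorphismProperty.Over.mk ⊤ (specZIsTerminal.from X) h

instance {X Y : SchZ} (f : X ⟶ Y) : LocallyOfFiniteType f.left :=
  have : LocallyOfFiniteType (f.left ≫ Y.hom) := by rw [w_left]; infer_instance
  locallyOfFiniteType_of_comp f.left Y.hom

instance {X Y : SchZ} (f : X ⟶ Y) : QuasiCompact f.left :=
  have : QuasiCompact (f.left ≫ Y.hom) := by rw [w_left]; infer_instance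
  QuasiCompact.of_comp f.left Y.hom

instance {X Y : SchZ} (f : X ⟶ Y) : LocallyOfFinitePresentation f.left :=
  LocallyOfFinitePresentation.iff_locallyOfFiniteType.mpr inferInstance

/-- The scheme-theoretic fibre product in `SchZ`. -/
noncomputable def fibreProduct {X Y S : SchZ} (f : X ⟶ S) (g : Y ⟶ S) : SchZ :=
  mk' (pullback f.left g.left) <| by
    rw [finitePresentationMorphisms_iff]
    constructor
    · rw [specZIsTerminal.hom_ext (specZIsTerminal.from _) (pullback.fst f.left g.left ≫ X.hom)]
      infer_instance
    · exact QuasiCompact.compactSpace_of_compactSpace (pullback.fst f.left g.left)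

theorem isPullback_of_left {P X Y S : SchZ} {p : P ⟶ X} {q : P ⟶ Y} {f : X ⟶ S} {g : Y ⟶ S}
    (h : IsPullback p.left q.left f.left g.left) : IsPullback p q f g where
  w := hom_ext h.w
  isLimit' := ⟨PullbackCone.IsLimit.mk _
    (fun s ↦ homMk (h.lift s.fst.left s.snd.left congr($(s.condition).left)))
    (fun _ ↦ hom_ext (h.lift_fst _ _ _)) (fun _ ↦ hom_ext (h.lift_snd _ _ _))
    (fun _ _ h₁ h₂ ↦ hom_ext (h.hom_ext
      ((congr($(h₁).left)).trans (h.lift_fst _ _ _).symm)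
      ((congr($(h₂).left)).trans (h.lift_snd _ _ _).symm)))⟩

theorem isPullback_fibreProduct {X Y S : SchZ} (f : X ⟶ S) (g : Y ⟶ S) :
    IsPullback (homMk (X := fibreProduct f g) (pullback.fst f.left g.left))
      (homMk (pullback.snd f.left g.left)) f g :=
  isPullback_of_left (IsPullback.of_hasPullback f.left g.left)

theorem isPullback_left {P X Y S : SchZ} {p : P ⟶ X} {q : P ⟶ Y} {f : X ⟶ S} {g : Y ⟶ S}
    (h : IsPullback p q f g) : IsPullback p.left q.left f.left g.left := by
  let e := h.isoIsPullback _ _ (isPullback_fibreProduct f g)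
  have e₁ : e.hom.left ≫ pullback.fst f.left g.left = p.left :=
    congr($(h.isoIsPullback_hom_fst _ _ (isPullback_fibreProduct f g)).left)
  have e₂ : e.hom.left ≫ pullback.snd f.left g.left = q.left :=
    congr($(h.isoIsPullback_hom_snd _ _ (isPullback_fibreProduct f g)).left)
  let e' : P.left ≅ pullback f.left g.left :=
    ⟨e.hom.left, e.inv.left, congr($(e.hom_inv_id).left), congr($(e.inv_hom_id).left)⟩
  exact IsPullback.of_iso_pullback ⟨congr($(h.w).left)⟩ e' e₁ e₂

end SchZ

end SchZ

/-! ### Ideal sheaves and effective Cartier divisors in affine charts -/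

section IdealSheaves

/-- The ideal of `D` corresponding to an ideal sheaf on `Spec D`. -/
noncomputable def specIdeal {D : CommRingCat.{0}} (J : (Spec D).IdealSheafData) : Ideal D :=
  (J.ideal ⟨⊤, isAffineOpen_top _⟩).comap (Scheme.ΓSpecIso D).inv.hom

/-- The ideal sheaf on `Spec D` with a given ideal of global sections. -/
noncomputable def ofSpecIdeal {D : CommRingCat.{0}} (K : Ideal D) : (Spec D).IdealSheafData :=
  Scheme.IdealSheafData.ofIdealTop (K.comap (Scheme.ΓSpecIso D).hom.hom)

theorem specIdeal_ofSpecIdeal {D : CommRingCat.{0}} (K : Ideal D) :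
    specIdeal (ofSpecIdeal K) = K := by
  ext x
  simp [specIdeal, ofSpecIdeal]

theorem le_iff_specIdeal_le {D : CommRingCat.{0}} {J K : (Spec D).IdealSheafData} :
    J ≤ K ↔ specIdeal J ≤ specIdeal K := by
  constructor
  · intro h
    exact Ideal.comap_mono (h _)
  · intro h
    refine Scheme.IdealSheafData.le_of_isAffine fun x hx ↦ ?_
    have := @h ((Scheme.ΓSpecIso D).hom x)
    simp only [specIdeal, Ideal.mem_comap] at this
    simpa [hx] using this

theorem specIdeal_map {C D : CommRingCat.{0}} (φ : C ⟶ D) (K : (Spec D).IdealSheafData) :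
    specIdeal (K.map (Spec.map φ)) = (specIdeal K).comap φ.hom := by
  have := Scheme.IdealSheafData.ideal_map_of_isAffineHom K (Spec.map φ) ⟨⊤, isAffineOpen_top _⟩
  ext x
  simp only [specIdeal, this, Ideal.mem_comap]
  rw [← CommRingCat.comp_apply, ← CommRingCat.comp_apply]
  have := Scheme.ΓSpecIso_inv_naturality φ
  erw [← this]
  rfl

/-- By adjunction: inverse image and extension of ideals are left adjoint to direct image and
contraction, so `specIdeal_map` decides. -/
theorem specIdeal_comap {C D : CommRingCat.{0}} (φ : C ⟶ D) (J : (Spec C).IdealSheafData) :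
    specIdeal (J.comap (Spec.map φ)) = (specIdeal J).map φ.hom := by
  refine eq_of_forall_ge_iff fun K ↦ ?_
  rw [← specIdeal_ofSpecIdeal K, ← le_iff_specIdeal_le, ← Scheme.IdealSheafData.le_map_iff_comap_le,
    le_iff_specIdeal_le, specIdeal_map, Ideal.map_le_iff_le_comap]

theorem specIdeal_ker {C D : CommRingCat.{0}} (φ : C ⟶ D) :
    specIdeal (Spec.map φ).ker = RingHom.ker φ.hom := by
  rw [specIdeal, Scheme.Hom.ker_apply]
  ext x
  simp only [Ideal.mem_comap, RingHom.mem_ker]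
  have h := Scheme.ΓSpecIso_inv_naturality φ
  have h' : (Scheme.ΓSpecIso D).inv.hom (φ.hom x) =
      ((Spec.map φ).app ⊤).hom ((Scheme.ΓSpecIso C).inv.hom x) :=
    congr($(h).hom x)
  rw [← h']
  exact map_eq_zero_iff _ (Scheme.ΓSpecIso D).symm.commRingCatIsoToRingEquiv.injective

theorem specIdeal_comap_openImmersion {T : Scheme.{0}} {D : CommRingCat.{0}} (h : Spec D ⟶ T)
    [IsOpenImmersion h] (J : T.IdealSheafData) :
    ∃ e : D ≃+* Γ(T, h ''ᵁ ⊤), specIdeal (J.comap h) =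
      (J.ideal ⟨h ''ᵁ ⊤, (isAffineOpen_top _).image_of_isOpenImmersion h⟩).comap e := by
  let e := (Scheme.ΓSpecIso D).symm ≪≫ (h.appIso ⊤).symm
  refine ⟨e.commRingCatIsoToRingEquiv, ?_⟩
  rw [specIdeal, Scheme.IdealSheafData.ideal_comap_of_isOpenImmersion]
  rfl

theorem mem_nonZeroDivisors_map_equiv {A B : Type*} [CommRing A] [CommRing B] (e : A ≃+* B)
    {x : A} : e x ∈ nonZeroDivisors B ↔ x ∈ nonZeroDivisors A := by
  rw [← MulEquivClass.map_nonZeroDivisors e]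
  simp

/-- Trading affine opens for open immersions from spectra turns all later verifications into
statements about ring maps. -/
theorem isEffectiveCartier_iff {T : Scheme.{0}} (J : T.IdealSheafData) :
    IsEffectiveCartier J ↔ ∀ x : T, ∃ (D : CommRingCat.{0}) (h : Spec D ⟶ T),
      IsOpenImmersion h ∧ x ∈ Set.range h ∧
        ∃ f ∈ nonZeroDivisors D, specIdeal (J.comap h) = Ideal.span {f} := by
  refine forall_congr' fun x ↦ ⟨?_, ?_⟩
  · rintro ⟨U, hx, hf⟩
    have : IsOpenImmersion U.2.fromSpec := IsAffineOpen.isOpenImmersion_fromSpec U.2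
    obtain ⟨e, he⟩ := specIdeal_comap_openImmersion U.2.fromSpec J
    have hU : (⟨U.2.fromSpec ''ᵁ ⊤, (isAffineOpen_top _).image_of_isOpenImmersion _⟩ :
        T.affineOpens) = U := Subtype.ext ((Scheme.Hom.image_top_eq_opensRange _).trans U.2.opensRange_fromSpec)
    rw [← hU] at hf
    obtain ⟨f, hf, hJ⟩ := hf
    refine ⟨_, U.2.fromSpec, inferInstance, by rwa [U.2.range_fromSpec], e.symm f, ?_, ?_⟩
    · rwa [← mem_nonZeroDivisors_map_equiv e, RingEquiv.apply_symm_apply]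
    · rw [he, hJ, ← Ideal.map_symm, Ideal.map_span, Set.image_singleton]
  · rintro ⟨D, h, h₁, ⟨y, rfl⟩, f, hf, hJ⟩
    obtain ⟨e, he⟩ := specIdeal_comap_openImmersion h J
    refine ⟨⟨h ''ᵁ ⊤, (isAffineOpen_top _).image_of_isOpenImmersion _⟩, ⟨y, trivial, rfl⟩, e f,
      ?_, ?_⟩
    · rwa [mem_nonZeroDivisors_map_equiv e]
    · rw [← Set.image_singleton, ← Ideal.map_span, ← hJ, he, Ideal.map_comap_of_surjective _ e.surjective]

theorem isEffectiveCartier_of_specIdeal_eq {D : CommRingCat.{0}} {J : (Spec D).IdealSheafData}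
    {f : D} (hf : f ∈ nonZeroDivisors D) (h : specIdeal J = Ideal.span {f}) :
    IsEffectiveCartier J :=
  (isEffectiveCartier_iff J).mpr fun x ↦
    ⟨D, 𝟙 _, inferInstance, ⟨x, rfl⟩, f, hf, by rwa [Scheme.IdealSheafData.comap_id]⟩

theorem exists_spec_openImmersion {T : Scheme.{0}} {x : T} {O : Set T} (hO : IsOpen O)
    (hx : x ∈ O) : ∃ (D : CommRingCat.{0}) (h : Spec D ⟶ T),
      IsOpenImmersion h ∧ x ∈ Set.range h ∧ Set.range h ⊆ O := by
  obtain ⟨U, hU, hxU, hUO⟩ := T.isBasis_affineOpens.exists_subset_of_mem_open hx hO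
  obtain ⟨U, hU, rfl⟩ := hU
  exact ⟨_, IsAffineOpen.fromSpec hU, IsAffineOpen.isOpenImmersion_fromSpec hU, by rwa [hU.range_fromSpec],
    by rwa [hU.range_fromSpec]⟩

theorem map_mem_nonZeroDivisors_of_flat {A B : Type*} [CommRing A] [CommRing B] {φ : A →+* B}
    (hφ : φ.Flat) {f : A} (hf : f ∈ nonZeroDivisors A) : φ f ∈ nonZeroDivisors B := by
  algebraize [φ]
  have := (isRegular_iff_mem_nonZeroDivisors.mpr hf).left.isSMulRegular.of_flat (S := B)
  refine mem_nonZeroDivisors_iff_right.mpr fun y hy ↦ this (?_ : f • y = f • 0)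
  rw [smul_zero, Algebra.smul_def, mul_comm]
  exact hy

theorem map_mem_nonZeroDivisors_of_openImmersion {A B : CommRingCat.{0}} {φ : A ⟶ B}
    [IsOpenImmersion (Spec.map φ)] {f : A} (hf : f ∈ nonZeroDivisors A) :
    φ.hom f ∈ nonZeroDivisors B :=
  map_mem_nonZeroDivisors_of_flat (HasRingHomProperty.Spec_iff.mp
    (inferInstance : Flat (Spec.map φ))) hf

/-- A morphism from an affine scheme landing in an affine open comes from a ring map. -/
theorem exists_specMap_comp {T : Scheme.{0}} {C D : CommRingCat.{0}} (g : Spec D ⟶ T)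
    (h : Spec C ⟶ T) [IsOpenImmersion h] (H : Set.range g ⊆ Set.range h) :
    ∃ φ : C ⟶ D, Spec.map φ ≫ h = g := by
  obtain ⟨φ, hφ⟩ := Spec.map_surjective (IsOpenImmersion.lift h g H)
  exact ⟨φ, by rw [hφ, IsOpenImmersion.lift_fac]⟩

/-- Open immersions are flat, so the local equation stays a nonzerodivisor. -/
theorem IsEffectiveCartier.comap_openImmersion {T T' : Scheme.{0}} {J : T.IdealSheafData}
    (hJ : IsEffectiveCartier J) (j : T' ⟶ T) [IsOpenImmersion j] :
    IsEffectiveCartier (J.comap j) := by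
  rw [isEffectiveCartier_iff] at hJ ⊢
  intro x
  obtain ⟨C, h, _, hx, f, hf, hJf⟩ := hJ (j x)
  obtain ⟨D, k, _, hxk, hk⟩ := exists_spec_openImmersion (O := j ⁻¹' Set.range h)
    (h.isOpenEmbedding.isOpen_range.preimage j.continuous) hx
  obtain ⟨φ, hφ⟩ := exists_specMap_comp (k ≫ j) h (by
    rintro _ ⟨y, rfl⟩
    exact hk ⟨y, rfl⟩)
  have : IsOpenImmersion (Spec.map φ ≫ h) := hφ ▸ inferInstance
  have : IsOpenImmersion (Spec.map φ) := IsOpenImmersion.of_comp _ h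
  refine ⟨D, k, inferInstance, hxk, φ.hom f, map_mem_nonZeroDivisors_of_openImmersion hf, ?_⟩
  rw [← Scheme.IdealSheafData.comap_comp, ← hφ, Scheme.IdealSheafData.comap_comp, specIdeal_comap,
    hJf, Ideal.map_span, Set.image_singleton]

end IdealSheaves

/-! ### Refinability along a morphism -/

section Refinement

variable {C : Type u} [Category.{v} C]

theorem CompositeOfPullbacks.mono {G G' : ∀ X : C, PreZeroHypercover.{0} X → Prop}
    (h : ∀ X E, G X E → G' X E) {X : C} {E : PreZeroHypercover.{0} X}
    (hE : CompositeOfPullbacks G X E) : CompositeOfPullbacks G' X E := by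
  induction hE with
  | pullback g E hE Y p q hq => exact .pullback g E (h _ _ hE) Y p q hq
  | comp E F _ _ ihE ihF => exact .comp E F ihE ihF

theorem IsRefinableBy.mono {G G' : ∀ X : C, PreZeroHypercover.{0} X → Prop}
    (h : ∀ X E, G X E → G' X E) {X : C} {U : PreZeroHypercover.{w} X}
    (hU : IsRefinableBy G U) : IsRefinableBy G' U := by
  obtain ⟨V, hV, f⟩ := hU
  exact ⟨V, hV.mono h, f⟩

/-- The family `U` over `X` becomes refinable by a composite of pullbacks after base change along
`g : S ⟶ X`; this is phrased without forming the base change. -/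
def IsRefinableAlong (G : ∀ X : C, PreZeroHypercover.{0} X → Prop) {X : C}
    (U : PreZeroHypercover.{w} X) {S : C} (g : S ⟶ X) : Prop :=
  ∃ V : PreZeroHypercover.{0} S, CompositeOfPullbacks G S V ∧
    ∀ j, ∃ (i : U.I₀) (k : V.X j ⟶ U.X i), k ≫ U.f i = V.f j ≫ g

variable {G : ∀ X : C, PreZeroHypercover.{0} X → Prop} {X : C} {U : PreZeroHypercover.{w} X}

theorem isRefinableBy_of_isRefinableAlong_id (h : IsRefinableAlong G U (𝟙 X)) :
    IsRefinableBy G U := by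
  obtain ⟨V, hV, h⟩ := h
  choose s k hk using h
  exact ⟨V, hV, ⟨{ s₀ := s, h₀ := k, w₀ := fun i ↦ by simpa using hk i }⟩⟩

/-- Used in contrapositive form: if refinability fails along `g`, it fails on some member of every
covering of the source. -/
theorem IsRefinableAlong.of_composite {S : C} {g : S ⟶ X} {E : PreZeroHypercover.{0} S}
    (hE : CompositeOfPullbacks G S E) (h : ∀ i, IsRefinableAlong G U (E.f i ≫ g)) :
    IsRefinableAlong G U g := by
  choose V hV h using h
  refine ⟨E.bind V, .comp E V hE hV, ?_⟩
  rintro ⟨i, j⟩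
  obtain ⟨a, k, hk⟩ := h i j
  exact ⟨a, k, hk.trans (Category.assoc _ _ _).symm⟩

theorem IsRefinableAlong.of_pullback {S T : C} {g : S ⟶ X} {t : S ⟶ T}
    {E : PreZeroHypercover.{0} T} (hE : G T E) (Y : E.I₀ → C) (p : ∀ i, Y i ⟶ S)
    (q : ∀ i, Y i ⟶ E.X i) (H : ∀ i, IsPullback (q i) (p i) (E.f i) t)
    (h : ∀ i, IsRefinableAlong G U (p i ≫ g)) : IsRefinableAlong G U g :=
  .of_composite (.pullback t E hE Y p q H) h

/-- The one-element family given by an identity morphism. -/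
def idFamily (S : C) : PreZeroHypercover.{0} S where
  I₀ := Unit
  X _ := S
  f _ := 𝟙 S

theorem IsRefinableAlong.of_family {S : C} {g : S ⟶ X} {E : PreZeroHypercover.{0} S}
    (hE : G S E) (h : ∀ i, IsRefinableAlong G U (E.f i ≫ g)) : IsRefinableAlong G U g :=
  .of_pullback (t := 𝟙 S) hE E.X E.f (fun _ ↦ 𝟙 _)
    (fun _ ↦ IsPullback.of_horiz_isIso ⟨by simp⟩) h

/-- Composites of pullbacks do not contain identity families by definition, hence `hid`; Zariski
coverings provide them. -/
theorem IsRefinableAlong.of_factors (hid : ∀ S : C, G S (idFamily S)) {S : C} {g : S ⟶ X}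
    (i : U.I₀) (k : S ⟶ U.X i) (hk : k ≫ U.f i = g) : IsRefinableAlong G U g :=
  ⟨idFamily S, .pullback (𝟙 S) (idFamily S) (hid S) _ _ (fun _ ↦ 𝟙 S)
    (fun _ ↦ IsPullback.id_vert (𝟙 S)), fun _ ↦ ⟨i, k, by simpa [idFamily] using hk⟩⟩

end Refinement

/-! ### Stability of chain coverings; Zariski coverings -/

section ChainCoverings

/-- Of two nonunits one divides the other, so their sum is a multiple of a nonunit. -/
theorem IsChainRing.isLocalRing {R : Type u} [CommRing R] (h : IsChainRing R) : IsLocalRing R := by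
  have := h.nontrivial
  refine IsLocalRing.of_nonunits_add fun a b ha hb ↦ ?_
  rcases h.ideal_total (Ideal.span {a}) (Ideal.span {b}) with hab | hab
  · obtain ⟨c, rfl⟩ := Ideal.span_singleton_le_span_singleton.mp hab
    rw [show b * c + b = b * (c + 1) by ring]
    exact mul_mem_nonunits_left hb
  · obtain ⟨c, rfl⟩ := Ideal.span_singleton_le_span_singleton.mp hab
    rw [show a + a * c = a * (1 + c) by ring]
    exact mul_mem_nonunits_left ha

theorem IsChainCovering.pullback {X X' : SchZ} (g : X' ⟶ X) {E : PreZeroHypercover.{0} X}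
    (hE : IsChainCovering E) (Y : E.I₀ → SchZ) (p : ∀ i, Y i ⟶ X') (q : ∀ i, Y i ⟶ E.X i)
    (h : ∀ i, IsPullback (q i) (p i) (E.f i) g) :
    IsChainCovering (⟨E.I₀, Y, p⟩ : PreZeroHypercover.{0} X') := by
  intro R _ hR x
  obtain ⟨i, y, hy⟩ := hE R hR (x ≫ g.left)
  have hi := SchZ.isPullback_left (h i)
  exact ⟨i, hi.lift y x hy, hi.lift_snd _ _ _⟩

theorem IsChainCovering.bind {X : SchZ} {E : PreZeroHypercover.{0} X}
    {F : ∀ i, PreZeroHypercover.{0} (E.X i)} (hE : IsChainCovering E)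
    (hF : ∀ i, IsChainCovering (F i)) : IsChainCovering (E.bind F) := by
  intro R _ hR x
  obtain ⟨i, y, hy⟩ := hE R hR x
  obtain ⟨j, z, hz⟩ := hF i R hR y
  refine ⟨⟨i, j⟩, z, ?_⟩
  rw [← hy, ← hz, Category.assoc]
  rfl

theorem IsChainCovering.of_composite {G : ∀ X : SchZ, PreZeroHypercover.{0} X → Prop}
    (h : ∀ X E, G X E → IsChainCovering E) {X : SchZ} {E : PreZeroHypercover.{0} X}
    (hE : CompositeOfPullbacks G X E) : IsChainCovering E := by
  induction hE with
  | pullback g E hE Y p q hq => exact (h _ _ hE).pullback g Y p q hq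
  | comp E F _ _ ihE ihF => exact ihE.bind ihF

theorem IsChainCovering.of_isRefinableBy {G : ∀ X : SchZ, PreZeroHypercover.{0} X → Prop}
    (h : ∀ X E, G X E → IsChainCovering E) {X : SchZ} {U : PreZeroHypercover.{w} X}
    (hU : IsRefinableBy G U) : IsChainCovering U := by
  obtain ⟨V, hV, ⟨f⟩⟩ := hU
  intro R _ hR x
  obtain ⟨j, y, rfl⟩ := IsChainCovering.of_composite h hV R hR x
  exact ⟨f.s₀ j, y ≫ (f.h₀ j).left, by
    rw [Category.assoc]; exact congr(y ≫ $(f.w₀ j).left)⟩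

/-- An open set containing the image of the closed point of a local scheme contains the whole image.
-/
theorem IsZariskiCovering.isChainCovering {X : SchZ} {E : PreZeroHypercover.{0} X}
    (hE : IsZariskiCovering X E) : IsChainCovering E := by
  intro R _ hR x
  have := hR.isLocalRing
  obtain ⟨i, hi⟩ := hE.2 (x (IsLocalRing.closedPoint R))
  have := hE.1 i
  refine ⟨i, IsOpenImmersion.lift (E.f i).left x ?_, IsOpenImmersion.lift_fac _ _ _⟩
  have h : x ⁻¹ᵁ (E.f i).left.opensRange = ⊤ :=
    (IsLocalRing.closed_point_mem_iff (R := R)).mp hi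
  rintro _ ⟨y, rfl⟩
  exact h.ge (show y ∈ ⊤ from trivial)

end ChainCoverings

/-! ### The ideal of the origin -/

section OriginIdeal

theorem ker_constantCoeff_eq_span (n : ℕ) :
    RingHom.ker (MvPolynomial.constantCoeff (R := ℤ) (σ := Fin n)) =
      Ideal.span (Set.range MvPolynomial.X) := by
  ext p
  rw [← Set.image_univ, MvPolynomial.mem_ideal_span_X_image, RingHom.mem_ker,
    MvPolynomial.constantCoeff_eq]
  constructor
  · intro h m hm
    by_contra! H
    have : m = 0 := Finsupp.ext fun i ↦ H i trivial
    exact (MvPolynomial.mem_support_iff.mp hm) (this ▸ h)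
  · intro h
    by_contra H
    obtain ⟨i, -, hi⟩ := h 0 (MvPolynomial.mem_support_iff.mpr H)
    exact hi rfl

/-- The inclusion of the origin of affine space, as a morphism of spectra. -/
noncomputable def originSpec (n : ℕ) :
    Spec (CommRingCat.of ℤ) ⟶ Spec (CommRingCat.of (MvPolynomial (Fin n) ℤ)) :=
  Spec.map (CommRingCat.ofHom MvPolynomial.constantCoeff)

instance (n : ℕ) : IsClosedImmersion (originSpec n) := by
  refine IsClosedImmersion.spec_of_surjective _ fun a ↦ ⟨MvPolynomial.C a, ?_⟩
  simp

/-- The ideal of the origin of affine space pulled back along a morphism from an affine scheme. -/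
theorem specIdeal_comap_origin {n : ℕ} {D : CommRingCat.{0}}
    (ψ : CommRingCat.of (MvPolynomial (Fin n) ℤ) ⟶ D) :
    specIdeal ((originSpec n).ker.comap (Spec.map ψ)) =
      Ideal.span (Set.range fun i ↦ ψ.hom (MvPolynomial.X i)) := by
  have : specIdeal (originSpec n).ker = Ideal.span (Set.range MvPolynomial.X) :=
    (specIdeal_ker _).trans (ker_constantCoeff_eq_span n)
  rw [specIdeal_comap, this, Ideal.map_span, ← Set.range_comp]
  rfl

end OriginIdeal

/-! ### The blowup of the plane as two glued charts -/

section BlowupOfPlane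

/-- The coordinate ring `ℤ[x₀, x₁]` of the plane, and also of the two charts of the blowup of the
plane in the origin. -/
noncomputable abbrev planeRing : CommRingCat.{0} := CommRingCat.of (MvPolynomial (Fin 2) ℤ)

/-- A ring map out of `ℤ[x₀, x₁]` with given values at the variables. -/
noncomputable def planeHom {D : CommRingCat.{0}} (a : Fin 2 → D) : planeRing ⟶ D :=
  CommRingCat.ofHom (MvPolynomial.aeval a).toRingHom

@[simp] theorem planeHom_X {D : CommRingCat.{0}} (a : Fin 2 → D) (i : Fin 2) :
    (planeHom a).hom (MvPolynomial.X i) = a i :=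
  MvPolynomial.aeval_X a i

theorem planeHom_ext {D : CommRingCat.{0}} {f g : planeRing ⟶ D}
    (h : ∀ i, f.hom (MvPolynomial.X i) = g.hom (MvPolynomial.X i)) : f = g :=
  CommRingCat.hom_ext (MvPolynomial.ringHom_ext' (RingHom.ext_int _ _) h)

/-- The inclusion of the coordinate ring of the plane into that of the `i`-th chart of the blowup,
with coordinates `x_i` and `x_{1 - i} / x_i`. -/
noncomputable def chartHom (i : Fin 2) : planeRing ⟶ planeRing :=
  planeHom fun j ↦ if j = i then MvPolynomial.X 0 else MvPolynomial.X 0 * MvPolynomial.X 1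

/-- The coordinate ring of the intersection of the two charts. -/
noncomputable abbrev overlapRing : CommRingCat.{0} :=
  CommRingCat.of (Localization.Away (MvPolynomial.X 1 : MvPolynomial (Fin 2) ℤ))

/-- The inclusion of the overlap into a chart. -/
noncomputable def overlapHom : planeRing ⟶ overlapRing :=
  CommRingCat.ofHom (algebraMap _ _)

/-- The inclusion of the overlap into the other chart. -/
noncomputable def overlapHom' : planeRing ⟶ overlapRing :=
  planeHom ![overlapHom (MvPolynomial.X 0) * overlapHom (MvPolynomial.X 1),
    IsLocalization.Away.invSelf (MvPolynomial.X 1 : MvPolynomial (Fin 2) ℤ)]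

theorem overlapHom_mul_inv : overlapHom.hom (MvPolynomial.X 1) * overlapHom'.hom (MvPolynomial.X 1)
    = 1 := by
  have : overlapHom'.hom (MvPolynomial.X 1) =
    IsLocalization.Away.invSelf (MvPolynomial.X 1 : MvPolynomial (Fin 2) ℤ) := planeHom_X _ _
  rw [this]
  exact IsLocalization.Away.mul_invSelf (MvPolynomial.X 1 : MvPolynomial (Fin 2) ℤ)

theorem exists_lift_overlap {D : CommRingCat.{0}} (χ : planeRing ⟶ D)
    (h : IsUnit (χ.hom (MvPolynomial.X 1))) : ∃ χ' : overlapRing ⟶ D, overlapHom ≫ χ' = χ :=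
  ⟨CommRingCat.ofHom (IsLocalization.Away.lift _ h), CommRingCat.hom_ext
    (IsLocalization.Away.lift_comp _ h)⟩

theorem overlap_hom_ext {D : CommRingCat.{0}} {f g : overlapRing ⟶ D}
    (h : overlapHom ≫ f = overlapHom ≫ g) : f = g :=
  CommRingCat.hom_ext (IsLocalization.ringHom_ext
    (Submonoid.powers (MvPolynomial.X 1 : MvPolynomial (Fin 2) ℤ)) congr($(h).hom))

/-- The change of charts is `(x, u) ↦ (x * u, u⁻¹)`, an involution. It shows that the second
inclusion of the overlap is also an open immersion, and that the gluing is symmetric in the charts.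
-/
theorem exists_overlap_swap : ∃ σ : overlapRing ⟶ overlapRing, overlapHom ≫ σ = overlapHom' ∧
    overlapHom' ≫ σ = overlapHom ∧ σ ≫ σ = 𝟙 _ := by
  obtain ⟨σ, hσ⟩ := exists_lift_overlap overlapHom' (.of_mul_eq_one_right _ overlapHom_mul_inv)
  have h (x) : σ.hom (overlapHom.hom x) = overlapHom'.hom x := congr($(hσ).hom x)
  have h₁ : σ.hom (overlapHom'.hom (MvPolynomial.X 1)) = overlapHom.hom (MvPolynomial.X 1) := by
    have h₁ := congr(σ.hom $overlapHom_mul_inv)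
    rw [map_mul, map_one, h] at h₁
    exact (left_inv_eq_right_inv overlapHom_mul_inv h₁).symm
  have h₂ : overlapHom' ≫ σ = overlapHom := by
    refine planeHom_ext fun i ↦ ?_
    fin_cases i
    · have : overlapHom'.hom (MvPolynomial.X 0) =
        overlapHom.hom (MvPolynomial.X 0) * overlapHom.hom (MvPolynomial.X 1) := planeHom_X _ _
      change σ.hom (overlapHom'.hom (MvPolynomial.X 0)) = overlapHom.hom (MvPolynomial.X 0)
      rw [this, map_mul, h, h, this, mul_assoc, overlapHom_mul_inv, mul_one]
    · exact h₁
  exact ⟨σ, hσ, h₂, overlap_hom_ext (by rw [reassoc_of% hσ, h₂, Category.comp_id])⟩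

instance : IsOpenImmersion (Spec.map overlapHom) :=
  IsOpenImmersion.of_isLocalization (MvPolynomial.X 1 : MvPolynomial (Fin 2) ℤ)

theorem chartHom_comp_overlapHom (i : Fin 2) :
    chartHom i ≫ overlapHom = chartHom (1 - i) ≫ overlapHom' := by
  refine planeHom_ext fun j ↦ ?_
  have h₀ : overlapHom'.hom (MvPolynomial.X 0) =
        overlapHom.hom (MvPolynomial.X 0) * overlapHom.hom (MvPolynomial.X 1) := planeHom_X _ _
  change overlapHom.hom ((chartHom i).hom (MvPolynomial.X j)) =
    overlapHom'.hom ((chartHom (1 - i)).hom (MvPolynomial.X j))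
  have h₁ := overlapHom_mul_inv
  have key : overlapHom'.hom (MvPolynomial.X 0) * overlapHom'.hom (MvPolynomial.X 1) =
      overlapHom.hom (MvPolynomial.X 0) := by rw [h₀, mul_assoc, h₁, mul_one]
  have h (i j : Fin 2) : (chartHom i).hom (MvPolynomial.X j) =
    if j = i then MvPolynomial.X 0 else MvPolynomial.X 0 * MvPolynomial.X 1 := planeHom_X _ _
  rw [h, h]
  have hij : j = 1 - i ↔ ¬ j = i := by omega
  split_ifs <;> simp_all

/-- The gluing data of the blowup of the plane in the origin: `B` is covered by two copies of the
plane, glued along the overlap. -/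
structure IsPlaneBlowupAtlas {B : Scheme.{0}} (b : B ⟶ Spec planeRing)
    (j : Fin 2 → (Spec planeRing ⟶ B)) : Prop where
  openImmersion : ∀ i, IsOpenImmersion (j i)
  covers : ∀ x : B, ∃ i, x ∈ Set.range (j i)
  fac : ∀ i, j i ≫ b = Spec.map (chartHom i)
  overlap : ∀ i, Spec.map overlapHom ≫ j i = Spec.map overlapHom' ≫ j (1 - i)

theorem exists_isPlaneBlowupAtlas : ∃ (B : Scheme.{0}) (b : B ⟶ Spec planeRing)
    (j : Fin 2 → (Spec planeRing ⟶ B)), IsPlaneBlowupAtlas b j := by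
  obtain ⟨σ, h₁, h₂, h₃⟩ := exists_overlap_swap
  have : IsIso σ := ⟨σ, h₃, h₃⟩
  have : IsOpenImmersion (Spec.map overlapHom') := by
    rw [← h₁, Spec.map_comp]
    infer_instance
  let f := Spec.map overlapHom
  let g := Spec.map overlapHom'
  have hw : f ≫ Spec.map (chartHom 0) = g ≫ Spec.map (chartHom 1) := by
    rw [← Spec.map_comp, ← Spec.map_comp]
    exact congr(Spec.map $(chartHom_comp_overlapHom 0))
  let ι : Fin 2 → (Spec planeRing ⟶ pushout f g) := ![pushout.inl f g, pushout.inr f g]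
  refine ⟨pushout f g, pushout.desc _ _ hw, ι, ?_, ?_, ?_, ?_⟩
  · intro i
    fin_cases i
    · exact inferInstanceAs (IsOpenImmersion (colimit.ι (span f g) WalkingSpan.left))
    · exact inferInstanceAs (IsOpenImmersion (colimit.ι (span f g) WalkingSpan.right))
  · intro x
    obtain ⟨i, y, hy⟩ := Scheme.IsLocallyDirected.ι_jointly_surjective (span f g) x
    rcases i with _ | _ | _
    · refine ⟨0, f y, ?_⟩
      rw [← hy, ← colimit.w (span f g) WalkingSpan.Hom.fst]
      rfl
    · exact ⟨0, y, hy⟩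
    · exact ⟨1, y, hy⟩
  · intro i
    fin_cases i
    · exact pushout.inl_desc _ _ _
    · exact pushout.inr_desc _ _ _
  · intro i
    fin_cases i
    · exact pushout.condition
    -- The relation for `i = 1` is the one for `i = 0` precomposed with the swap.
    · have : f ≫ pushout.inl f g = g ≫ pushout.inr f g := pushout.condition
      have := congr(Spec.map σ ≫ $this)
      simp only [f, g, ← Category.assoc, ← Spec.map_comp, h₁, h₂] at this
      exact this.symm

end BlowupOfPlane

/-! ### The universal property of the glued blowup -/

section BlowupUniversalProperty

/-- A morphism from an open piece of `T` on which the pullback of `x_i` is a nonzerodivisor that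
divides the pullback of `x_{1 - i}`. -/
structure IsAdaptedChart {T : Scheme.{0}} (t : T ⟶ Spec planeRing) (i : Fin 2)
    {D : CommRingCat.{0}} (h : Spec D ⟶ T) (ψ : planeRing ⟶ D) (s : D) : Prop where
  openImmersion : IsOpenImmersion h
  fac : h ≫ t = Spec.map ψ
  mem_nonZeroDivisors : ψ.hom (MvPolynomial.X i) ∈ nonZeroDivisors D
  eq_mul : ψ.hom (MvPolynomial.X (1 - i)) = ψ.hom (MvPolynomial.X i) * s

/-- Locally `(x₀, x₁) = (f)`, with `x_i = f * α i` and `f = ∑ c i * x_i`. Cancelling `f` gives `∑ c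
i * α i = 1`, so some `α i` is invertible near the point, and there `x_i` generates the ideal. -/
theorem exists_isAdaptedChart {T : Scheme.{0}} (t : T ⟶ Spec planeRing)
    (ht : IsEffectiveCartier ((originSpec 2).ker.comap t)) (x : T) :
    ∃ (i : Fin 2) (D : CommRingCat.{0}) (h : Spec D ⟶ T) (ψ : planeRing ⟶ D) (s : D),
      IsAdaptedChart t i h ψ s ∧ x ∈ Set.range h := by
  obtain ⟨D, h, _, ⟨y, rfl⟩, f, hf, hJ⟩ := (isEffectiveCartier_iff _).mp ht x
  obtain ⟨ψ, hψ⟩ := Spec.map_surjective (h ≫ t)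
  rw [← Scheme.IdealSheafData.comap_comp, ← hψ, specIdeal_comap_origin] at hJ
  have hα (i : Fin 2) : ∃ α, ψ.hom (MvPolynomial.X i) = f * α :=
    Ideal.mem_span_singleton.mp (hJ ▸ Ideal.subset_span ⟨i, rfl⟩)
  choose α hα using hα
  obtain ⟨c, hc⟩ := (Ideal.mem_span_range_iff_exists_fun (R := D)).mp
    (hJ.symm ▸ Ideal.mem_span_singleton_self f)
  have h1 : ∑ i, c i * α i = 1 := by
    refine sub_eq_zero.mp ((mem_nonZeroDivisors_iff_right.mp hf) _ ?_)
    rw [sub_mul, one_mul, sub_eq_zero, Finset.sum_mul]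
    refine (Finset.sum_congr rfl fun i _ ↦ ?_).trans hc
    simp only [hα]
    ring
  obtain ⟨i, hi⟩ : ∃ i, α i ∉ y.asIdeal := by
    by_contra! H
    exact y.2.ne_top ((Ideal.eq_top_iff_one _).mpr
      (h1 ▸ Ideal.sum_mem _ fun i _ ↦ Ideal.mul_mem_left _ _ (H i)))
  let ρ : D ⟶ CommRingCat.of (Localization.Away (α i)) := CommRingCat.ofHom (algebraMap _ _)
  have : IsOpenImmersion (Spec.map ρ) := IsOpenImmersion.of_isLocalization (α i)
  have hu : IsUnit (ρ.hom (α i)) := IsLocalization.Away.algebraMap_isUnit _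
  obtain ⟨r, hr⟩ := hu.exists_right_inv
  refine ⟨i, _, Spec.map ρ ≫ h, ψ ≫ ρ, ρ.hom (α (1 - i)) * r,
    ⟨inferInstance, by rw [Category.assoc, ← hψ, Spec.map_comp], ?_, ?_⟩, ?_⟩
  · change ρ.hom (ψ.hom _) ∈ _
    rw [hα, map_mul]
    exact mul_mem (map_mem_nonZeroDivisors_of_openImmersion hf) hu.mem_nonZeroDivisors
  · change ρ.hom (ψ.hom _) = ρ.hom (ψ.hom _) * _
    rw [hα, hα, map_mul, map_mul]
    linear_combination (-ρ.hom f * ρ.hom (α (1 - i))) * hr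
  · have : y ∈ Set.range (Spec.map ρ) := by
      have := PrimeSpectrum.localization_away_comap_range (Localization.Away (α i)) (α i)
      change y ∈ Set.range (PrimeSpectrum.comap (algebraMap _ (Localization.Away (α i))))
      rw [this]
      exact hi
    obtain ⟨z, rfl⟩ := this
    exact ⟨z, rfl⟩

theorem Scheme.hom_ext_of_openImmersions {T B : Scheme.{0}} (g g' : T ⟶ B)
    (H : ∀ x : T, ∃ (D : CommRingCat.{0}) (h : Spec D ⟶ T), IsOpenImmersion h ∧ x ∈ Set.range h ∧
      h ≫ g = h ≫ g') : g = g' := by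
  refine AlgebraicGeometry.Scheme.hom_ext_of_forall g g' fun x ↦ ?_
  obtain ⟨D, h, _, hx, e⟩ := H x
  refine ⟨h.opensRange, hx, ?_⟩
  rw [← cancel_epi h.isoOpensRange.hom]
  simpa using e

variable {B : Scheme.{0}} {b : B ⟶ Spec planeRing} {j : Fin 2 → (Spec planeRing ⟶ B)}

theorem chartHom_X_self (i : Fin 2) :
    (chartHom i).hom (MvPolynomial.X i) = MvPolynomial.X 0 := by
  refine (planeHom_X (D := planeRing) _ i).trans ?_
  simp

theorem chartHom_X_other (i : Fin 2) :
    (chartHom i).hom (MvPolynomial.X (1 - i)) = MvPolynomial.X 0 * MvPolynomial.X 1 := by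
  have : 1 - i ≠ i := by omega
  refine (planeHom_X (D := planeRing) _ (1 - i)).trans ?_
  simp [this]

theorem IsPlaneBlowupAtlas.comp_eq (hB : IsPlaneBlowupAtlas b j) {i : Fin 2} {D : CommRingCat.{0}}
    {ψ : planeRing ⟶ D} {χ : planeRing ⟶ D} (h : (Spec.map χ ≫ j i) ≫ b = Spec.map ψ) :
    χ.hom (MvPolynomial.X 0) = ψ.hom (MvPolynomial.X i) ∧
      χ.hom (MvPolynomial.X 0) * χ.hom (MvPolynomial.X 1) = ψ.hom (MvPolynomial.X (1 - i)) := by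
  rw [Category.assoc, hB.fac, ← Spec.map_comp] at h
  have h := Spec.map_injective h
  rw [← h, ← chartHom_X_self i, ← map_mul]
  refine ⟨rfl, ?_⟩
  rw [chartHom_X_self, ← chartHom_X_other i]
  rfl

/-- Where the lift meets the other chart, the ratio coordinate there times `s` equals `1`, after
cancelling the nonzerodivisor `x_i`. So the ratio is a unit and the point lies in the overlap. -/
theorem IsPlaneBlowupAtlas.range_subset (hB : IsPlaneBlowupAtlas b j) {T : Scheme.{0}}
    {t : T ⟶ Spec planeRing} {i : Fin 2} {D : CommRingCat.{0}} {h : Spec D ⟶ T}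
    {ψ : planeRing ⟶ D} {s : D} (hc : IsAdaptedChart t i h ψ s) {g : T ⟶ B} (hg : g ≫ b = t) :
    Set.range (h ≫ g) ⊆ Set.range (j i) := by
  rintro _ ⟨y, rfl⟩
  obtain ⟨i', hi'⟩ := hB.covers ((h ≫ g) y)
  by_cases hii : i' = i
  · rwa [← hii]
  obtain rfl : i' = 1 - i := by omega
  have := hB.openImmersion (1 - i)
  obtain ⟨E, k, _, ⟨z, rfl⟩, hk⟩ := exists_spec_openImmersion
    (O := (h ≫ g) ⁻¹' Set.range (j (1 - i)))
    ((j (1 - i)).isOpenEmbedding.isOpen_range.preimage (h ≫ g).continuous) hi'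
  obtain ⟨χ, hχ⟩ := exists_specMap_comp (k ≫ h ≫ g) (j (1 - i)) (by
    rintro _ ⟨y, rfl⟩
    exact hk ⟨y, rfl⟩)
  obtain ⟨κ, rfl⟩ := Spec.map_surjective k
  have hκ : (Spec.map χ ≫ j (1 - i)) ≫ b = Spec.map (ψ ≫ κ) := by
    rw [hχ, Category.assoc, Category.assoc, hg, hc.fac, Spec.map_comp]
  obtain ⟨e₁, e₂⟩ := hB.comp_eq hκ
  have hi : 1 - (1 - i) = i := by omega
  have hn : κ.hom (ψ.hom (MvPolynomial.X i)) ∈ nonZeroDivisors E :=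
    map_mem_nonZeroDivisors_of_openImmersion hc.mem_nonZeroDivisors
  have e₃ := congr(κ.hom $(hc.eq_mul))
  rw [hi] at e₂
  rw [map_mul] at e₃
  change _ = κ.hom (ψ.hom _) at e₁ e₂
  have hu : χ.hom (MvPolynomial.X 1) * κ.hom s = 1 := by
    refine sub_eq_zero.mp ((mem_nonZeroDivisors_iff_right.mp hn) _ ?_)
    rw [e₁, e₃] at e₂
    linear_combination e₂
  obtain ⟨χ', rfl⟩ := exists_lift_overlap χ (.of_mul_eq_one _ hu)
  have := congr($hχ z)
  rw [Spec.map_comp, Category.assoc, hB.overlap, hi] at this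
  change (j i) (Spec.map overlapHom' (Spec.map χ' z)) = _ at this
  exact ⟨_, this⟩

/-- On an adapted chart any lift lands in the `i`-th chart with coordinates forced to be `x_i` and
`s`, the second by cancelling `x_i`. -/
theorem IsPlaneBlowupAtlas.hom_unique (hB : IsPlaneBlowupAtlas b j) {T : Scheme.{0}}
    {t : T ⟶ Spec planeRing} (ht : IsEffectiveCartier ((originSpec 2).ker.comap t))
    {g g' : T ⟶ B} (hg : g ≫ b = t) (hg' : g' ≫ b = t) : g = g' := by
  refine Scheme.hom_ext_of_openImmersions g g' fun x ↦ ?_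
  obtain ⟨i, D, h, ψ, s, hc, hx⟩ := exists_isAdaptedChart t ht x
  refine ⟨D, h, hc.openImmersion, hx, ?_⟩
  have := hB.openImmersion i
  have key {g : T ⟶ B} (hg : g ≫ b = t) : h ≫ g =
      Spec.map (planeHom ![ψ.hom (MvPolynomial.X i), s]) ≫ j i := by
    obtain ⟨χ, hχ⟩ := exists_specMap_comp (h ≫ g) (j i) (hB.range_subset hc hg)
    obtain ⟨e₁, e₂⟩ := hB.comp_eq (ψ := ψ) (χ := χ) (i := i) (by
      rw [hχ, Category.assoc, hg, hc.fac])
    rw [← hχ]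
    congr 2
    refine planeHom_ext fun k ↦ ?_
    rw [planeHom_X]
    fin_cases k
    · exact e₁
    · refine sub_eq_zero.mp ((mem_nonZeroDivisors_iff_right.mp hc.mem_nonZeroDivisors) _ ?_)
      rw [e₁, hc.eq_mul] at e₂
      simp only [Fin.mk_one, Matrix.cons_val_one, Matrix.cons_val_fin_one]
      linear_combination e₂
  rw [key hg, key hg']

/-- The coordinates `(x_i, s)` define the lift locally; agreement on overlaps is uniqueness, applied
to the restricted Cartier divisor. -/
theorem IsPlaneBlowupAtlas.exists_lift (hB : IsPlaneBlowupAtlas b j) {T : Scheme.{0}}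
    {t : T ⟶ Spec planeRing} (ht : IsEffectiveCartier ((originSpec 2).ker.comap t)) :
    ∃ g : T ⟶ B, g ≫ b = t := by
  choose i D h ψ s hc hx using exists_isAdaptedChart t ht
  have := fun x ↦ (hc x).openImmersion
  let 𝒰 : T.OpenCover := Scheme.Cover.mkOfCovers T (fun x ↦ Spec (D x)) h
    (fun x ↦ ⟨x, hx x⟩) this
  let f (x : T) : Spec (D x) ⟶ B :=
    Spec.map (planeHom ![(ψ x).hom (MvPolynomial.X (i x)), s x]) ≫ j (i x)
  have hf (x : T) : f x ≫ b = h x ≫ t := by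
    rw [(hc x).fac, Category.assoc, hB.fac, ← Spec.map_comp]
    congr 1
    refine planeHom_ext fun k ↦ ?_
    change (planeHom _).hom ((chartHom (i x)).hom _) = _
    obtain rfl | rfl : k = i x ∨ k = 1 - i x := by omega
    · rw [chartHom_X_self, planeHom_X]
      rfl
    · rw [chartHom_X_other, map_mul, planeHom_X, planeHom_X, (hc x).eq_mul]
      rfl
  have hff (x y : T) : pullback.fst (h x) (h y) ≫ f x = pullback.snd (h x) (h y) ≫ f y := by
    refine hB.hom_unique (t := pullback.fst (h x) (h y) ≫ h x ≫ t) ?_ ?_ ?_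
    · rw [← Category.assoc, Scheme.IdealSheafData.comap_comp]
      exact ht.comap_openImmersion _
    · rw [Category.assoc, hf]
    · rw [Category.assoc, hf, pullback.condition_assoc]
  refine ⟨𝒰.glueMorphisms f hff, 𝒰.hom_ext _ _ fun x ↦ ?_⟩
  exact (𝒰.ι_glueMorphisms_assoc f hff x b).trans (hf x)

theorem IsPlaneBlowupAtlas.isBlowup (hB : IsPlaneBlowupAtlas b j) :
    IsBlowup (originSpec 2) b where
  closedImmersion := inferInstance
  cartier := by
    rw [isEffectiveCartier_iff]
    intro x
    obtain ⟨i, hi⟩ := hB.covers x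
    refine ⟨planeRing, j i, hB.openImmersion i, hi, MvPolynomial.X 0,
      mem_nonZeroDivisors_of_ne_zero (MvPolynomial.X_ne_zero _), ?_⟩
    rw [← Scheme.IdealSheafData.comap_comp, hB.fac, specIdeal_comap_origin]
    refine le_antisymm (Ideal.span_le.mpr ?_) ?_
    · rintro _ ⟨k, rfl⟩
      change (chartHom i).hom (MvPolynomial.X k) ∈ Ideal.span {MvPolynomial.X 0}
      obtain rfl | rfl : k = i ∨ k = 1 - i := by omega
      · rw [chartHom_X_self]
        exact Ideal.mem_span_singleton_self _
      · rw [chartHom_X_other]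
        exact Ideal.mul_mem_right _ _ (Ideal.mem_span_singleton_self _)
    · rw [Ideal.span_singleton_le_iff_mem, ← chartHom_X_self i]
      exact Ideal.subset_span ⟨i, rfl⟩
  universal T t ht := by
    obtain ⟨g, hg⟩ := hB.exists_lift ht
    exact ⟨g, hg, fun g' hg' ↦ hB.hom_unique ht hg' hg⟩

end BlowupUniversalProperty

/-! ### Towers of countable rings whose colimit is a chain ring -/

section Towers

/-- Dovetailing: the `m`-th pair of stage `n` is task `Nat.pair n m`, treated in the step leaving
stage `Nat.pair n m`. That stage is not earlier than `n`, so the pair already has an image there. -/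
theorem exists_tower {State : Type u} [Nonempty State] (A : State → CommRingCat.{0})
    (hA : ∀ S, Countable (A S)) (Q : ∀ S S', (A S ⟶ A S') → Prop)
    (step : ∀ S (a b : A S), ∃ (S' : State) (φ : A S ⟶ A S'), Q S S' φ ∧
      (φ.hom a ∣ φ.hom b ∨ φ.hom b ∣ φ.hom a)) :
    ∃ (S : ℕ → State) (f : ∀ n, A (S n) ⟶ A (S (n + 1))), (∀ n, Q _ _ (f n)) ∧
      ∀ (n : ℕ) (a b : A (S n)), ∃ (k : ℕ) (h : n ≤ k),
        ((Functor.ofSequence f).map (homOfLE h)).hom a ∣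
          ((Functor.ofSequence f).map (homOfLE h)).hom b ∨
        ((Functor.ofSequence f).map (homOfLE h)).hom b ∣
          ((Functor.ofSequence f).map (homOfLE h)).hom a := by
  obtain ⟨S₀⟩ := ‹Nonempty State›
  have he (S : State) : ∃ e : ℕ → A S × A S, Function.Surjective e :=
    exists_surjective_nat (A S × A S)
  choose e he using he
  choose N φ hφQ hφ using step
  -- The second component is the task list read in the current ring. Tasks from stages up to `k` are
  -- transported; those of stage `k + 1` are read off its enumeration, and entries for later stages
  -- are placeholders, replaced when those stages are reached.
  let next (k : ℕ) (σ : Σ S : State, ℕ → A S × A S) : Σ S : State, ℕ → A S × A S :=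
    ⟨N σ.1 (σ.2 k).1 (σ.2 k).2, fun l ↦
      if l.unpair.1 ≤ k then
        ((φ σ.1 (σ.2 k).1 (σ.2 k).2).hom (σ.2 l).1, (φ σ.1 (σ.2 k).1 (σ.2 k).2).hom (σ.2 l).2)
      else e _ l.unpair.2⟩
  let σ (k : ℕ) : Σ S : State, ℕ → A S × A S :=
    Nat.rec ⟨S₀, fun l ↦ e S₀ l.unpair.2⟩ next k
  let f (k : ℕ) : A (σ k).1 ⟶ A (σ (k + 1)).1 := φ (σ k).1 ((σ k).2 k).1 ((σ k).2 k).2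
  have h₁ (k l : ℕ) (h : l.unpair.1 ≤ k) :
      (σ (k + 1)).2 l = ((f k).hom ((σ k).2 l).1, (f k).hom ((σ k).2 l).2) := if_pos h
  have h₂ (n m : ℕ) : (σ n).2 (Nat.pair n m) = e (σ n).1 m := by
    cases n with
    | zero =>
      change e S₀ (Nat.unpair (Nat.pair 0 m)).2 = e S₀ m
      rw [Nat.unpair_pair]
    | succ k =>
      refine (if_neg ?_).trans ?_
      · simp
      · rw [Nat.unpair_pair]
  refine ⟨fun k ↦ (σ k).1, f, fun n ↦ hφQ _ _ _, fun n a b ↦ ?_⟩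
  set F := Functor.ofSequence f with hF
  obtain ⟨m, hm⟩ := he (σ n).1 (a, b)
  have hs (k : ℕ) (h : n ≤ k) : F.map (homOfLE (h.trans (Nat.le_add_right k 1))) =
      F.map (homOfLE h) ≫ f k := by
    refine (F.map_comp (homOfLE h) (homOfLE (Nat.le_add_right k 1))).trans ?_
    exact congr(F.map (homOfLE h) ≫ $(Functor.ofSequence_map_homOfLE_succ f k))
  have h₃ (k : ℕ) (h : n ≤ k) : (σ k).2 (Nat.pair n m) =
      ((F.map (homOfLE h)).hom a, (F.map (homOfLE h)).hom b) := by
    induction k, h using Nat.le_induction with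
    | base =>
      rw [h₂, hm]
      have : homOfLE (le_refl n) = 𝟙 n := rfl
      rw [this, F.map_id]
      rfl
    | succ k h ih =>
      rw [h₁ _ _ (by simpa), ih, hs k h]
      rfl
  have hl : n ≤ Nat.pair n m := Nat.left_le_pair n m
  refine ⟨Nat.pair n m + 1, hl.trans (Nat.le_add_right _ 1), ?_⟩
  have := hφ (σ (Nat.pair n m)).1 ((σ (Nat.pair n m)).2 (Nat.pair n m)).1
    ((σ (Nat.pair n m)).2 (Nat.pair n m)).2
  rw [hs _ hl]
  change (f _).hom _ ∣ (f _).hom _ ∨ (f _).hom _ ∣ (f _).hom _ at this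
  rw [h₃ _ hl] at this
  exact this

theorem isChainRing_of_dvd_total {R : Type*} [CommRing R] [Nontrivial R]
    (h : ∀ a b : R, a ∣ b ∨ b ∣ a) : IsChainRing R where
  nontrivial := inferInstance
  ideal_total I J := by
    by_contra! H
    obtain ⟨x, hxI, hxJ⟩ := SetLike.not_le_iff_exists.mp H.1
    obtain ⟨y, hyJ, hyI⟩ := SetLike.not_le_iff_exists.mp H.2
    rcases h x y with h | h
    · exact hyI (I.mem_of_dvd h hxI)
    · exact hxJ (J.mem_of_dvd h hyJ)

/-- Two elements of the colimit come from a common stage, and a divisibility reached later pushes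
forward; `0 = 1` would hold at a finite stage. -/
theorem isChainRing_of_isColimit {F : ℕ ⥤ CommRingCat.{0}} {c : Cocone F} (hc : IsColimit c)
    (h0 : ∀ n, Nontrivial (F.obj n))
    (h : ∀ (n : ℕ) (a b : F.obj n), ∃ (k : ℕ) (h : n ≤ k),
      (F.map (homOfLE h)).hom a ∣ (F.map (homOfLE h)).hom b ∨
        (F.map (homOfLE h)).hom b ∣ (F.map (homOfLE h)).hom a) :
    IsChainRing c.pt := by
  have hw {n k : ℕ} (f : n ⟶ k) (a : F.obj n) : (c.ι.app k).hom ((F.map f).hom a) =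
      (c.ι.app n).hom a := congr($(c.w f).hom a)
  have : Nontrivial c.pt := by
    refine ⟨0, 1, fun H ↦ ?_⟩
    obtain ⟨k, f, g, hfg⟩ := Concrete.isColimit_exists_of_rep_eq.{0} (C := CommRingCat.{0}) F hc
      (i := 0) (j := 0) (0 : F.obj 0) (1 : F.obj 0) (by
        change (c.ι.app 0).hom 0 = (c.ι.app 0).hom 1
        rw [map_zero, map_one, H])
    change (F.map f).hom 0 = (F.map g).hom 1 at hfg
    rw [map_zero, map_one] at hfg
    have := h0 k
    exact zero_ne_one hfg
  refine isChainRing_of_dvd_total fun a b ↦ ?_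
  obtain ⟨n, a, rfl⟩ := Concrete.isColimit_exists_rep (C := CommRingCat.{0}) F hc a
  obtain ⟨m, b, rfl⟩ := Concrete.isColimit_exists_rep (C := CommRingCat.{0}) F hc b
  change (c.ι.app n).hom a ∣ (c.ι.app m).hom b ∨ (c.ι.app m).hom b ∣ (c.ι.app n).hom a
  rw [← hw (homOfLE (le_max_left n m)) a, ← hw (homOfLE (le_max_right n m)) b]
  obtain ⟨k, hk, h⟩ := h (max n m) ((F.map (homOfLE (le_max_left n m))).hom a)
    ((F.map (homOfLE (le_max_right n m))).hom b)
  rw [← hw (homOfLE hk), ← hw (homOfLE hk)]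
  exact h.imp (map_dvd _) (map_dvd _)

theorem countable_of_finiteType {A : Type} [CommRing A] [Algebra.FiniteType ℤ A] : Countable A := by
  obtain ⟨n, f, hf⟩ := (Algebra.FiniteType.iff_quotient_mvPolynomial'' (R := ℤ) (S := A)).mp
    inferInstance
  have : Countable (MvPolynomial (Fin n) ℤ) :=
    Cardinal.mk_le_aleph0_iff.mp (MvPolynomial.cardinalMk_le_max_lift.trans (by simp))
  exact hf.countable

end Towers

/-! ### The blowup of the plane as a `ℤ`-scheme of finite presentation -/

section PlaneBlowupInSchZ

namespace SchZ

/-- The spectrum of a ring of finite type, as an object of `SchZ`. -/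
noncomputable def spec (A : CommRingCat.{0}) (hA : LocallyOfFiniteType (specZIsTerminal.from (Spec A))) :
    SchZ :=
  mk' (Spec A) ((finitePresentationMorphisms_iff _).mpr ⟨hA, inferInstance⟩)

theorem locallyOfFiniteType_of_openImmersion {S : SchZ} {T : Scheme.{0}} (h : T ⟶ S.left)
    [IsOpenImmersion h] : LocallyOfFiniteType (specZIsTerminal.from T) := by
  rw [specZIsTerminal.hom_ext (specZIsTerminal.from T) (h ≫ S.hom)]
  infer_instance

theorem finiteType_of_locallyOfFiniteType {A : CommRingCat.{0}}
    (hA : LocallyOfFiniteType (specZIsTerminal.from (Spec A))) : Algebra.FiniteType ℤ A := by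
  rw [specZIsTerminal.hom_ext (specZIsTerminal.from (Spec A))
    (Spec.map (CommRingCat.ofHom (algebraMap ℤ A))), HasRingHomProperty.Spec_iff
      (P := @LocallyOfFiniteType)] at hA
  exact RingHom.finiteType_algebraMap.mp hA

end SchZ

theorem exists_planeBlowup : ∃ (B : SchZ) (b : B ⟶ affineSpaceZ 2)
    (j : Fin 2 → (Spec planeRing ⟶ B.left)), IsPlaneBlowupAtlas (B := B.left) b.left j ∧
      IsBlowup (originZ 2).left b.left := by
  obtain ⟨B, b, j, hB⟩ := exists_isPlaneBlowupAtlas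
  have := hB.openImmersion
  have h₁ : LocallyOfFiniteType (specZIsTerminal.from B) := by
    let 𝒰 : B.OpenCover := Scheme.Cover.mkOfCovers (Fin 2) (fun _ ↦ Spec planeRing) j hB.covers this
    have : IsZariskiLocalAtSource @LocallyOfFiniteType.{0} :=
      HasRingHomProperty.instIsZariskiLocalAtSource (P := @LocallyOfFiniteType)
        (Q := RingHom.FiniteType)
    refine (IsZariskiLocalAtSource.iff_of_openCover (P := @LocallyOfFiniteType.{0}) 𝒰).mpr fun i ↦ ?_
    rw [specZIsTerminal.hom_ext (𝒰.f i ≫ specZIsTerminal.from B) (affineSpaceZ 2).hom]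
    exact (inferInstance : LocallyOfFiniteType (affineSpaceZ 2).hom)
  have h₂ : CompactSpace B := by
    refine ⟨?_⟩
    have : (Set.univ : Set B) = ⋃ i, Set.range (j i) := by
      ext x
      simpa using hB.covers x
    rw [this]
    exact isCompact_iUnion fun i ↦ isCompact_range (j i).continuous
  let B' : SchZ := SchZ.mk' B ((finitePresentationMorphisms_iff _).mpr ⟨h₁, h₂⟩)
  exact ⟨B', SchZ.homMk (X := B') (Y := affineSpaceZ 2) b, j, hB, hB.isBlowup⟩

end PlaneBlowupInSchZ

/-! ### Chain coverings are refinable by blowups of the plane -/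

section ChainCoveringsAreRefinable

theorem isZariskiCovering_idFamily (S : SchZ) : IsZariskiCovering S (idFamily S) :=
  ⟨fun _ ↦ inferInstanceAs (IsOpenImmersion (𝟙 S.left)), fun x ↦ ⟨(), x, rfl⟩⟩

variable {G : ∀ X : SchZ, PreZeroHypercover.{0} X → Prop}
  (hG : ∀ S E, IsZariskiCovering S E → G S E) {X : SchZ} {U : PreZeroHypercover.{w} X}

include hG

theorem exists_affine_not_isRefinableAlong {Y : SchZ} {g : Y ⟶ X} (hg : ¬ IsRefinableAlong G U g)
    (P : ∀ A : CommRingCat.{0}, (Spec A ⟶ Y.left) → Prop)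
    (hP : ∀ y : Y.left, ∃ (A : CommRingCat.{0}) (h : Spec A ⟶ Y.left), IsOpenImmersion h ∧
      y ∈ Set.range h ∧ P A h) :
    ∃ (A : CommRingCat.{0}) (hA : LocallyOfFiniteType (specZIsTerminal.from (Spec A)))
      (h : Spec A ⟶ Y.left), P A h ∧
        ¬ IsRefinableAlong G U (SchZ.homMk (X := SchZ.spec A hA) (h ≫ g.left)) := by
  choose A h hh hy hP using hP
  have hA (y) := SchZ.locallyOfFiniteType_of_openImmersion (h y)
  by_contra! H
  refine hg (IsRefinableAlong.of_family (E := ⟨Y.left, fun y ↦ SchZ.spec (A y) (hA y),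
    fun y ↦ SchZ.homMk (h y)⟩) (hG _ _ ⟨hh, fun y ↦ ⟨y, hy y⟩⟩) fun y ↦ ?_)
  exact H (A y) (hA y) (h y) (hP y)

/-- The spectrum of the zero ring is covered by the empty family. This keeps the colimit of the
tower nonzero. -/
theorem nontrivial_of_not_isRefinableAlong {A : CommRingCat.{0}}
    {hA : LocallyOfFiniteType (specZIsTerminal.from (Spec A))} {g : SchZ.spec A hA ⟶ X}
    (hg : ¬ IsRefinableAlong G U g) : Nontrivial A := by
  by_contra H
  rw [not_nontrivial_iff_subsingleton] at H
  refine hg (IsRefinableAlong.of_family (E := ⟨PEmpty, PEmpty.elim, fun i ↦ i.elim⟩)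
    (hG _ _ ⟨fun i ↦ i.elim, fun x ↦ ?_⟩) fun i ↦ i.elim)
  exact (PrimeSpectrum.isEmpty_iff_subsingleton.mpr H).elim (show PrimeSpectrum A from x)

/-- Refinability fails on some member of the plane family pulled back along `(a, b)`. Over the
origin `a` and `b` become zero; over a chart of the blowup one becomes a multiple of the other. -/
theorem exists_step (hG₂ : ∀ S E, IsOriginBlowupFamily 2 S E → G S E) {A : CommRingCat.{0}}
    {hA : LocallyOfFiniteType (specZIsTerminal.from (Spec A))} {g : Spec A ⟶ X.left}
    (hg : ¬ IsRefinableAlong G U (SchZ.homMk (X := SchZ.spec A hA) g)) (a b : A) :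
    ∃ (A' : CommRingCat.{0}) (hA' : LocallyOfFiniteType (specZIsTerminal.from (Spec A')))
      (φ : A ⟶ A'), (φ.hom a ∣ φ.hom b ∨ φ.hom b ∣ φ.hom a) ∧
        ¬ IsRefinableAlong G U (SchZ.homMk (X := SchZ.spec A' hA') (Spec.map φ ≫ g)) := by
  obtain ⟨B, π, j, hB, hπ⟩ := exists_planeBlowup
  let ψ : planeRing ⟶ A := planeHom ![a, b]
  let S := SchZ.spec A hA
  let t : S ⟶ affineSpaceZ 2 := SchZ.homMk (X := S) (Y := affineSpaceZ 2) (Spec.map ψ)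
  let E := pairFamily (originZ 2) π
  let p (i : E.I₀) : SchZ.fibreProduct (E.f i) t ⟶ S :=
    SchZ.homMk (X := SchZ.fibreProduct (E.f i) t) (pullback.snd (E.f i).left t.left)
  let q (i : E.I₀) : SchZ.fibreProduct (E.f i) t ⟶ E.X i :=
    SchZ.homMk (X := SchZ.fibreProduct (E.f i) t) (pullback.fst (E.f i).left t.left)
  have H (i : E.I₀) : IsPullback (q i) (p i) (E.f i) t := SchZ.isPullback_fibreProduct _ _
  obtain ⟨i, hi⟩ : ∃ i, ¬ IsRefinableAlong G U (p i ≫ SchZ.homMk (X := S) g) := by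
    by_contra! h
    exact hg (.of_pullback (hG₂ _ _ ⟨π, hπ⟩) _ p q H h)
  have key (y : (SchZ.fibreProduct (E.f i) t).left) : ∃ (A' : CommRingCat.{0})
      (h : Spec A' ⟶ (SchZ.fibreProduct (E.f i) t).left), IsOpenImmersion h ∧ y ∈ Set.range h ∧
        ∃ φ : A ⟶ A', Spec.map φ = h ≫ (p i).left ∧
          (φ.hom a ∣ φ.hom b ∨ φ.hom b ∣ φ.hom a) := by
    have hw := congr($((H i).w).left)
    have h₀ : ψ.hom (MvPolynomial.X 0) = a := planeHom_X _ _
    have h₁ : ψ.hom (MvPolynomial.X 1) = b := planeHom_X _ _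
    rcases i with _ | _
    · let q₀ : (SchZ.fibreProduct (E.f false) t).left ⟶ Spec (CommRingCat.of ℤ) := (q false).left
      let p₀ : (SchZ.fibreProduct (E.f false) t).left ⟶ Spec A := (p false).left
      have hw : q₀ ≫ originSpec 2 = p₀ ≫ Spec.map ψ := hw
      obtain ⟨A', h, hh, hy, -⟩ := exists_spec_openImmersion (x := y) isOpen_univ trivial
      obtain ⟨φ, hφ⟩ := Spec.map_surjective (h ≫ p₀)
      refine ⟨A', h, hh, hy, φ, hφ, ?_⟩
      obtain ⟨χ, hχ⟩ := Spec.map_surjective (R := CommRingCat.of ℤ) (h ≫ q₀)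
      have e : Spec.map χ ≫ originSpec 2 = Spec.map φ ≫ Spec.map ψ := by
        rw [hχ, hφ, Category.assoc, Category.assoc, hw]
      rw [originSpec, ← Spec.map_comp, ← Spec.map_comp] at e
      have e := Spec.map_injective e
      have e (i) : φ.hom (ψ.hom (MvPolynomial.X i)) = 0 := by
        refine (congr($(e.symm).hom (MvPolynomial.X i))).trans ?_
        change χ.hom (MvPolynomial.constantCoeff (MvPolynomial.X i)) = 0
        rw [MvPolynomial.constantCoeff_X, map_zero]
      rw [← h₀, ← h₁, e, e]
      exact .inl (dvd_refl _)
    · let q₀ : (SchZ.fibreProduct (E.f true) t).left ⟶ B.left := (q true).left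
      let p₀ : (SchZ.fibreProduct (E.f true) t).left ⟶ Spec A := (p true).left
      have hw : q₀ ≫ π.left = p₀ ≫ Spec.map ψ := hw
      obtain ⟨i, hi⟩ := hB.covers (q₀ y)
      have := hB.openImmersion i
      obtain ⟨A', h, hh, hy, hO⟩ := exists_spec_openImmersion (x := y)
        (O := q₀ ⁻¹' Set.range (j i))
        ((j i).isOpenEmbedding.isOpen_range.preimage q₀.continuous) hi
      obtain ⟨φ, hφ⟩ := Spec.map_surjective (h ≫ p₀)
      refine ⟨A', h, hh, hy, φ, hφ, ?_⟩
      obtain ⟨χ, hχ⟩ := exists_specMap_comp (h ≫ q₀) (j i) (by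
        rintro _ ⟨z, rfl⟩
        exact hO ⟨z, rfl⟩)
      obtain ⟨e₁, e₂⟩ := hB.comp_eq (ψ := ψ ≫ φ) (χ := χ) (i := i) (by
        rw [hχ, Spec.map_comp, hφ, Category.assoc]
        exact (Category.assoc _ _ _).trans congr(h ≫ $hw))
      have hd : φ.hom (ψ.hom (MvPolynomial.X i)) ∣ φ.hom (ψ.hom (MvPolynomial.X (1 - i))) :=
        ⟨_, e₂.symm.trans (congrArg (· * _) e₁)⟩
      rw [← h₀, ← h₁]
      fin_cases i
      · exact .inl hd
      · exact .inr hd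
  obtain ⟨A', hA', h, ⟨φ, hφ, hdvd⟩, hr⟩ := exists_affine_not_isRefinableAlong hG hi _ key
  refine ⟨A', hA', φ, hdvd, ?_⟩
  have : h ≫ (p i ≫ SchZ.homMk (X := S) g).left = Spec.map φ ≫ g :=
    (Category.assoc _ _ _).symm.trans congr($(hφ.symm) ≫ g)
  exact (congrArg (fun k : (SchZ.spec A' hA').left ⟶ X.left ↦
    ¬ IsRefinableAlong G U (SchZ.homMk k)) this).mp hr

theorem IsChainCovering.isRefinableBy (hG₂ : ∀ S E, IsOriginBlowupFamily 2 S E → G S E)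
    (hU : IsChainCovering U) : IsRefinableBy G U := by
  refine isRefinableBy_of_isRefinableAlong_id ?_
  by_contra hX
  -- The states are affine schemes of finite type over `X` on which refinability fails.
  let State := Σ A : CommRingCat.{0}, { g : Spec A ⟶ X.left //
    ∃ hA : LocallyOfFiniteType (specZIsTerminal.from (Spec A)),
      ¬ IsRefinableAlong G U (SchZ.homMk (X := SchZ.spec A hA) g) }
  have : Nonempty State := by
    obtain ⟨A, hA, h, -, hr⟩ := exists_affine_not_isRefinableAlong hG hX (fun _ _ ↦ True)
      fun y ↦ by
        obtain ⟨A, h, hh, hy, -⟩ := exists_spec_openImmersion (x := y) isOpen_univ trivial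
        exact ⟨A, h, hh, hy, trivial⟩
    exact ⟨A, _, hA, hr⟩
  obtain ⟨S, f, hf, hdvd⟩ := exists_tower (fun S : State ↦ S.1)
    (fun S ↦ by
      obtain ⟨A, g, hA, -⟩ := S
      have := SchZ.finiteType_of_locallyOfFiniteType hA
      exact countable_of_finiteType)
    (fun S S' φ ↦ Spec.map φ ≫ S.2.1 = S'.2.1)
    (fun S a b ↦ by
      obtain ⟨A, g, hA, hg⟩ := S
      obtain ⟨A', hA', φ, hd, hr⟩ := exists_step hG hG₂ hg a b
      exact ⟨⟨A', _, hA', hr⟩, φ, rfl, hd⟩)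
  let F := Functor.ofSequence f
  have hR : IsChainRing (colimit F : CommRingCat.{0}) := isChainRing_of_isColimit (colimit.isColimit F)
    (fun n ↦ by
      obtain ⟨hA, hr⟩ := (S n).2.2
      exact nontrivial_of_not_isRefinableAlong hG hr) hdvd
  let D : ℕᵒᵖ ⥤ Scheme.{0} := F.op ⋙ Scheme.Spec
  let c : Cone D := Scheme.Spec.mapCone (colimit.cocone F).op
  have hc : IsLimit c := isLimitOfPreserves Scheme.Spec (colimit.isColimit F).op
  let t : D ⟶ (Functor.const _).obj X.left := NatTrans.ofOpSequence (fun n ↦ (S n).2.1) fun n ↦ by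
    have : D.map (homOfLE (Nat.le_add_right n 1)).op = Spec.map (f n) :=
      congr(Spec.map $(Functor.ofSequence_map_homOfLE_succ f n))
    rw [this]
    exact (hf n).trans (Category.comp_id _).symm
  obtain ⟨i, y, hy⟩ := hU (colimit F : CommRingCat.{0}) hR (c.π.app (.op 0) ≫ t.app (.op 0))
  have (n : ℕᵒᵖ) : IsAffine (D.obj n) := inferInstanceAs (IsAffine (Spec (F.obj n.unop)))
  have {m n : ℕᵒᵖ} (f : m ⟶ n) : IsAffineHom (D.map f) := inferInstance
  -- `Spec` of the colimit is the limit of the affine stages, so a lift to a locally finitely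
  -- presented `X`-scheme descends to some stage `n`, where refinability was assumed to fail.
  obtain ⟨n, g, -, hg⟩ := Scheme.exists_π_app_comp_eq_of_locallyOfFinitePresentation D t
    (U.f i).left c hc y (by
      ext n
      refine Eq.trans ?_ hy.symm
      have e₁ := t.naturality (homOfLE (Nat.zero_le n.unop)).op
      have e₂ := c.w (homOfLE (Nat.zero_le n.unop)).op
      rw [← e₂, Category.assoc, e₁]
      rfl)
  obtain ⟨hA, hr⟩ := (S n.unop).2.2
  exact hr (.of_factors (fun S ↦ hG _ _ (isZariskiCovering_idFamily S)) i
    (SchZ.homMk (X := SchZ.spec _ hA) g) (SchZ.hom_ext hg))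

end ChainCoveringsAreRefinable

/-! ### Points of smooth blowups in chain rings -/

open scoped TensorProduct in
/-- A map of algebras with formally smooth, essentially finite type source and target, whose
differential is injective at the closed point, is flat. -/
theorem flat_of_injective_lTensor_mapBaseChange {k P L : Type} [CommRing k] [CommRing P]
    [CommRing L] [IsLocalRing L] [Algebra k P] [Algebra k L] [Algebra P L] [IsScalarTower k P L]
    [IsNoetherianRing P] [Module.Free P Ω[P⁄k]] [Module.Finite P Ω[P⁄k]]
    [Algebra.FormallySmooth k L] [Algebra.EssFiniteType k L] [Module.Free L Ω[L⁄k]]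
    (H : Function.Injective ((KaehlerDifferential.mapBaseChange k P L).lTensor
      (IsLocalRing.ResidueField L))) : Module.Flat P L := by
  have hfree : Module.Free L Ω[L⁄P] :=
    Module.free_of_lTensor_residueField_injective _ _
      (KaehlerDifferential.map_surjective k P L)
      (KaehlerDifferential.exact_mapBaseChange_map k P L) H
  obtain ⟨l, hl⟩ :=
    (IsLocalRing.split_injective_iff_lTensor_residueField_injective _).mpr H
  have hinj : Function.Injective (KaehlerDifferential.mapBaseChange k P L) :=
    Function.HasLeftInverse.injective ⟨l, LinearMap.congr_fun hl⟩
  -- In the Jacobi–Zariski sequence `H1Cotangent k L` vanishes and the map out of `L ⊗ Ω[P⁄k]` is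
  -- injective, which squeezes `H1Cotangent P L` to zero. With `Ω[L⁄P]` free this gives formal
  -- smoothness over `P`.
  have hH : Subsingleton (Algebra.H1Cotangent P L) := by
    refine subsingleton_of_forall_eq 0 fun x => ?_
    have h0 : Algebra.H1Cotangent.δ k P L x = 0 := hinj <| by
      rw [(Algebra.H1Cotangent.exact_δ_mapBaseChange k P L).apply_apply_eq_zero, map_zero]
    obtain ⟨y, rfl⟩ := (Algebra.H1Cotangent.exact_map_δ k P L x).mp h0
    rw [Subsingleton.elim y 0, map_zero]
  have : Algebra.FormallySmooth P L := ⟨inferInstance, hH⟩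
  have : Algebra.EssFiniteType P L := .of_comp k P L
  let s := Algebra.EssFiniteType.finset P L
  let φ : MvPolynomial s P →ₐ[P] L := MvPolynomial.aeval Subtype.val
  -- Inverting every polynomial that becomes a unit presents `L` as a quotient of a flat Noetherian
  -- `P`-algebra; formal smoothness then passes flatness to `L`.
  let M : Submonoid (MvPolynomial s P) := (IsUnit.submonoid L).comap φ
  let ψ : Localization M →ₐ[P] L := IsLocalization.liftAlgHom (M := M) (f := φ) fun y => y.2
  have hψ (p : MvPolynomial s P) : ψ (algebraMap _ _ p) = φ p :=
    IsLocalization.lift_eq (M := M) (g := φ.toRingHom) (fun y => y.2) p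
  have hsurj : Function.Surjective ψ := by
    intro x
    have hr : φ.range = Algebra.adjoin P (s : Set L) := by
      rw [← Algebra.adjoin_range_eq_range_aeval]
      simp
    obtain ⟨⟨a, t⟩, h⟩ := IsLocalization.surj (Algebra.EssFiniteType.submonoid P L) x
    obtain ⟨p, hp⟩ : a.1 ∈ φ.range := hr ▸ a.2
    obtain ⟨q, hq⟩ : t.1.1 ∈ φ.range := hr ▸ t.1.2
    have hu : IsUnit t.1.1 := t.2
    have hqM : q ∈ M := by
      change IsUnit (φ q)
      exact hq ▸ hu
    refine ⟨IsLocalization.mk' _ p (⟨q, hqM⟩ : M), hu.mul_left_injective ?_⟩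
    change _ * _ = x * _
    refine Eq.trans ?_ h.symm
    rw [← hq]
    change ψ _ * φ q = a.1
    rw [← hψ, ← map_mul, IsLocalization.mk'_spec _ _ (⟨q, hqM⟩ : M), hψ]
    exact hp
  have : Module.Flat P (Localization M) := .trans _ (MvPolynomial s P) _
  have : IsNoetherianRing (Localization M) := IsLocalization.isNoetherianRing M _ inferInstance
  exact Algebra.FormallySmooth.flat_of_algHom_of_isNoetherianRing ψ hsurj

open scoped TensorProduct in
/-- An ideal `J` of a smooth local ring with smooth quotient is generated by finitely many elements
`f i` for which `k[X] → L, X i ↦ f i` is flat. -/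
theorem exists_flat_aeval_of_formallySmooth_quotient {k L : Type} [CommRing k] [IsNoetherianRing k]
    [CommRing L] [IsLocalRing L] [Algebra k L] [Algebra.FormallySmooth k L]
    [Algebra.EssFiniteType k L] (J : Ideal L) (hJ : J ≠ ⊤) [Algebra.FormallySmooth k (L ⧸ J)] :
    ∃ (ι : Type) (_ : Finite ι) (f : ι → L), Ideal.span (Set.range f) = J ∧
      (MvPolynomial.aeval (R := k) f).toRingHom.Flat := by
  have : IsNoetherianRing L := Algebra.EssFiniteType.isNoetherianRing k L
  have : Module.Free L Ω[L⁄k] := Module.free_of_flat_of_isLocalRing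
  have : Nontrivial (L ⧸ J) := Ideal.Quotient.nontrivial_iff.mpr hJ
  have : IsLocalRing (L ⧸ J) := .of_surjective' _ Ideal.Quotient.mk_surjective
  have hker : RingHom.ker (algebraMap L (L ⧸ J)) = J := Ideal.mk_ker
  let K := IsLocalRing.ResidueField L
  have hJm : J ≤ IsLocalRing.maximalIdeal L := IsLocalRing.le_maximalIdeal hJ
  let π : L ⧸ J →+* K := Ideal.Quotient.factor hJm
  let : Algebra (L ⧸ J) K := π.toAlgebra
  have : IsScalarTower L (L ⧸ J) K := .of_algebraMap_eq fun _ => rfl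
  -- Jacobian criterion: smoothness of the quotient makes the conormal map injective over the
  -- residue field.
  have hinj : Function.Injective (KaehlerDifferential.cotangentComplexBaseChange k (L ⧸ J) L K) :=
    (Algebra.FormallySmooth.iff_injective_cotangentComplexBaseChange L K
      Ideal.Quotient.mk_surjective (IsNoetherian.noetherian _) fun x hx => by
        obtain ⟨y, rfl⟩ := Ideal.Quotient.mk_surjective x
        have hy : y ∈ IsLocalRing.maximalIdeal L := fun h => hx (h.map (Ideal.Quotient.mk J))
        exact Ideal.Quotient.eq_zero_iff_mem.mpr hy).mp inferInstance
  let I : Ideal L := RingHom.ker (algebraMap L (L ⧸ J))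
  -- By Nakayama, a lift of a basis of the conormal fibre generates the ideal.
  let b := Module.Free.chooseBasis K (K ⊗[L] I)
  obtain ⟨v, hv⟩ := (TensorProduct.mk_surjective L I K Ideal.Quotient.mk_surjective).comp_left b
  have hspan := IsLocalRing.span_eq_top_of_tmul_eq_basis v b (congr_fun hv)
  let ι := Module.Free.ChooseBasisIndex K (K ⊗[L] I)
  let f : ι → L := fun i => (v i).1
  refine ⟨ι, inferInstance, f, ?_, ?_⟩
  · have := congr_arg (Submodule.map I.subtype) hspan
    rw [Submodule.map_span, Submodule.map_top, Submodule.range_subtype, ← Set.range_comp] at this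
    exact this.trans hker
  let : Algebra (MvPolynomial ι k) L := (MvPolynomial.aeval (R := k) f).toAlgebra
  have : IsScalarTower k (MvPolynomial ι k) L := .of_algebraMap_eq fun x => by
    simp [RingHom.algebraMap_toAlgebra]
  have : Module.Finite (MvPolynomial ι k) Ω[MvPolynomial ι k⁄k] := inferInstance
  have hflat : Module.Flat (MvPolynomial ι k) L := by
    apply flat_of_injective_lTensor_mapBaseChange (k := k)
    let c := ((KaehlerDifferential.mvPolynomialBasis k ι).baseChange L).baseChange K
    -- Both maps send the `i`-th basis vector to `d (f i)`, so the differential at the closed point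
    -- inherits injectivity from the conormal map.
    have h : (KaehlerDifferential.mapBaseChange k (MvPolynomial ι k) L).baseChange K =
        KaehlerDifferential.cotangentComplexBaseChange k (L ⧸ J) L K ∘ₗ
          (c.equiv b (Equiv.refl ι)).toLinearMap := by
      refine c.ext fun i => ?_
      have hfi : algebraMap (MvPolynomial ι k) L (MvPolynomial.X i) = f i :=
        MvPolynomial.aeval_X _ _
      rw [LinearMap.comp_apply, LinearEquiv.coe_coe, Module.Basis.equiv_apply]
      have hb : b i = 1 ⊗ₜ v i := (congr_fun hv i).symm
      rw [Equiv.refl_apply, hb, KaehlerDifferential.cotangentComplexBaseChange_tmul]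
      simp [c, hfi, f]
    have h' : Function.Injective
        ((KaehlerDifferential.mapBaseChange k (MvPolynomial ι k) L).baseChange K) := by
      rw [h]
      exact hinj.comp (LinearEquiv.injective _)
    exact h'
  exact hflat

open scoped TensorProduct in
/-- Pushing a nonzerodivisor out along a flat homomorphism. -/
theorem exists_pushout_mem_nonZeroDivisors {P P' L R : Type} [CommRing P] [CommRing P']
    [CommRing L] [CommRing R] (χ : P →+* P') {θ : P →+* L} (hθ : θ.Flat) {x : P'}
    (hx : x ∈ nonZeroDivisors P') {g : P' →+* R} {α : L →+* R} (h : g.comp χ = α.comp θ) :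
    ∃ (T : Type) (_ : CommRing T) (a : P' →+* T) (β : L →+* T) (γ : T →+* R),
      a.comp χ = β.comp θ ∧ γ.comp β = α ∧ a x ∈ nonZeroDivisors T := by
  let : Algebra P P' := χ.toAlgebra
  let : Algebra P L := θ.toAlgebra
  let : Algebra P R := (α.comp θ).toAlgebra
  have : Module.Flat P L := hθ
  let g' : P' →ₐ[P] R := { g with commutes' := fun y => congr($h y) }
  let α' : L →ₐ[P] R := { α with commutes' := fun y => rfl }
  have hc : ∀ y z, Commute (g' y) (α' z) := fun _ _ => Commute.all _ _
  refine ⟨P' ⊗[P] L, inferInstance, Algebra.TensorProduct.includeLeftRingHom,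
    Algebra.TensorProduct.includeRight.toRingHom,
    (Algebra.TensorProduct.lift g' α' hc).toRingHom, ?_, ?_, ?_⟩
  · exact Algebra.TensorProduct.includeLeftRingHom_comp_algebraMap
  · ext y
    change Algebra.TensorProduct.lift g' α' hc (1 ⊗ₜ y) = α y
    rw [Algebra.TensorProduct.lift_tmul, map_one, one_mul]
    rfl
  · refine map_mem_nonZeroDivisors_of_flat ?_ hx
    exact RingHom.flat_algebraMap_iff.mpr (inferInstance : Module.Flat P' (P' ⊗[P] L))

theorem IsChainRing.dvd_total {R : Type u} [CommRing R] (hR : IsChainRing R) (a b : R) :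
    a ∣ b ∨ b ∣ a := by
  simpa [Ideal.mem_span_singleton] using
    (hR.ideal_total (Ideal.span {a}) (Ideal.span {b})).symm

theorem IsChainRing.exists_forall_dvd {R : Type u} [CommRing R] (hR : IsChainRing R) {ι : Type*}
    [Finite ι] [Nonempty ι] (a : ι → R) : ∃ i, ∀ j, a i ∣ a j := by
  have hd : Directed (fun p q => q ∣ p) a := fun i j =>
    (hR.dvd_total (a i) (a j)).elim (fun h => ⟨i, dvd_rfl, h⟩) fun h => ⟨j, h, dvd_rfl⟩
  have : IsTrans R (fun p q : R => q ∣ p) := ⟨fun _ _ _ h h' => h'.trans h⟩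
  obtain ⟨i, hi⟩ := hd.finite_le id
  exact ⟨i, hi⟩

/-- A homomorphism from `L` to a chain ring either kills the ideal generated by a flat sequence, or
factors through a ring in which this ideal becomes invertible. -/
theorem exists_principal_factorization_of_flat {k L R ι : Type} [CommRing k] [CommRing L]
    [CommRing R] [Algebra k L] [Finite ι] (hR : IsChainRing R) (f : ι → L)
    (hf : (MvPolynomial.aeval (R := k) f).toRingHom.Flat) (α : L →+* R) :
    Ideal.span (Set.range f) ≤ RingHom.ker α ∨
      ∃ (T : Type) (_ : CommRing T) (β : L →+* T) (γ : T →+* R), γ.comp β = α ∧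
        ∃ x ∈ nonZeroDivisors T, (Ideal.span (Set.range f)).map β = Ideal.span {x} := by
  classical
  cases isEmpty_or_nonempty ι
  · left
    simp [Set.range_eq_empty]
  right
  obtain ⟨i, hi⟩ := hR.exists_forall_dvd (α ∘ f)
  choose t ht using hi
  -- `χ` is the `i`-th chart of the blowup of affine space in the origin, and `g` is the `R`-point
  -- of it with ratios `t j`.
  let χ : MvPolynomial ι k →ₐ[k] MvPolynomial ι k := MvPolynomial.aeval fun j =>
    if j = i then MvPolynomial.X i else MvPolynomial.X i * MvPolynomial.X j
  let g : MvPolynomial ι k →+* R := MvPolynomial.eval₂Hom (α.comp (algebraMap k L))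
    fun j => if j = i then α (f i) else t j
  obtain ⟨T, _, a, β, γ, h₁, h₂, h₃⟩ := exists_pushout_mem_nonZeroDivisors (g := g) (α := α)
    χ.toRingHom hf (MvPolynomial.isRegular_X (n := i)).mem_nonZeroDivisors (by
      refine MvPolynomial.ringHom_ext (fun r => by simp [χ, g]) fun j => ?_
      by_cases hj : j = i
      · subst hj; simp [χ, g]
      · simpa [χ, g, hj] using (ht j).symm)
  have hβ (j : ι) : β (f j) = a (χ (MvPolynomial.X j)) := by
    simpa using congr($h₁ (MvPolynomial.X j)).symm
  refine ⟨T, inferInstance, β, γ, h₂, _, h₃, ?_⟩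
  rw [Ideal.map_span, ← Set.range_comp]
  refine le_antisymm (Ideal.span_le.mpr ?_) ((Ideal.span_singleton_le_iff_mem _).mpr ?_)
  · rintro _ ⟨j, rfl⟩
    rw [Function.comp_apply, hβ, SetLike.mem_coe, Ideal.mem_span_singleton]
    refine map_dvd a ?_
    by_cases hj : j = i <;> simp [χ, hj]
  · exact Ideal.subset_span ⟨i, by simp [hβ, χ]⟩

/-- A homomorphism from a smooth algebra to a chain ring either kills a given ideal with smooth
quotient, or factors through a ring in which this ideal becomes invertible. -/
theorem exists_principal_factorization_of_smooth {k A R : Type} [CommRing k] [IsNoetherianRing k]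
    [CommRing A] [CommRing R] [Algebra k A] [Algebra.Smooth k A] (hR : IsChainRing R)
    (I : Ideal A) [Algebra.Smooth k (A ⧸ I)] (α : A →+* R) :
    I ≤ RingHom.ker α ∨
      ∃ (T : Type) (_ : CommRing T) (β : A →+* T) (γ : T →+* R), γ.comp β = α ∧
        ∃ x ∈ nonZeroDivisors T, I.map β = Ideal.span {x} := by
  have := hR.isLocalRing
  -- Localising at the image of the closed point of `R` loses nothing: `R` is local, so `α` sends
  -- the complement of `p` to units.
  let p : Ideal A := (IsLocalRing.maximalIdeal R).comap α
  let L := Localization.AtPrime p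
  have hp (y : p.primeCompl) : IsUnit (α y) := of_not_not y.2
  let α' : L →+* R := IsLocalization.lift hp
  have hα' : α'.comp (algebraMap A L) = α := IsLocalization.lift_comp hp
  let J : Ideal L := I.map (algebraMap A L)
  -- Here the point misses the centre, whose ideal is generated by `1`.
  by_cases hJ : J = ⊤
  · refine .inr ⟨L, inferInstance, algebraMap A L, α', hα', 1, one_mem _, ?_⟩
    rw [Ideal.span_singleton_one]
    exact hJ
  have : Algebra.FormallySmooth A L := .of_isLocalization p.primeCompl
  have : Algebra.FormallySmooth k L := .comp k A L
  have : Algebra.EssFiniteType A L := .of_isLocalization L p.primeCompl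
  have : Algebra.EssFiniteType k L := .comp k A L
  have : Algebra.FormallySmooth k (L ⧸ J) := by
    have : Algebra.FormallySmooth (A ⧸ I) (L ⧸ J) :=
      .of_equiv (Algebra.TensorProduct.quotIdealMapEquivQuotTensor L I).symm
    have : IsScalarTower k (A ⧸ I) (L ⧸ J) := .of_algebraMap_eq' rfl
    exact .comp k (A ⧸ I) (L ⧸ J)
  obtain ⟨ι, _, f, hf, hflat⟩ := exists_flat_aeval_of_formallySmooth_quotient (k := k) J hJ
  have h := exists_principal_factorization_of_flat hR f hflat α'
  rw [hf] at h
  refine h.imp (fun h x hx => ?_) ?_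
  · rw [← hα']
    exact h (Ideal.mem_map_of_mem _ hx)
  · rintro ⟨T, _, β, γ, h₁, x, hx, h₂⟩
    exact ⟨T, inferInstance, β.comp (algebraMap A L), γ, by rw [← RingHom.comp_assoc, h₁, hα'], x,
      hx, by rw [← Ideal.map_map]; exact h₂⟩

theorem smooth_of_smooth_spec {A : CommRingCat.{0}} (f : Spec A ⟶ Spec (CommRingCat.of ℤ))
    (hf : Smooth f) : Algebra.Smooth ℤ A := by
  obtain ⟨φ, rfl⟩ := Spec.map_surjective f
  have h := (HasRingHomProperty.Spec_iff (P := @Smooth)).mp hf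
  rw [RingHom.ext_int φ.hom (algebraMap ℤ A)] at h
  exact RingHom.smooth_algebraMap.mp h

/-- A point of a smooth `ℤ`-scheme in a chain ring lifts to a given smooth closed subscheme or to
its blowup. -/
theorem IsBlowup.exists_lift_of_smooth {Z S B : Scheme.{0}} {i : Z ⟶ S} {b : B ⟶ S}
    (h : IsBlowup i b) (s : S ⟶ Spec (CommRingCat.of ℤ)) (hS : Smooth s) (hZ : Smooth (i ≫ s))
    {R : Type} [CommRing R] (hR : IsChainRing R) (x : Spec (CommRingCat.of R) ⟶ S) :
    (∃ y, y ≫ i = x) ∨ ∃ y, y ≫ b = x := by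
  have := hR.isLocalRing
  have := h.closedImmersion
  obtain ⟨A, j, _, hj, -⟩ := exists_spec_openImmersion (T := S) isOpen_univ
    (Set.mem_univ (x (IsLocalRing.closedPoint R)))
  obtain ⟨α, rfl⟩ := exists_specMap_comp x j <| by
    have h : x ⁻¹ᵁ j.opensRange = ⊤ := (IsLocalRing.closed_point_mem_iff (R := R)).mp hj
    rintro _ ⟨y, rfl⟩
    exact h.ge (show y ∈ ⊤ from trivial)
  obtain ⟨I, e, he⟩ := IsClosedImmersion.Spec_iff.mp
    (inferInstance : IsClosedImmersion (pullback.fst j i))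
  have hI : specIdeal (i.ker.comap j) = I := by
    rw [← Scheme.IdealSheafData.ker_fst_of_isClosedImmersion, he, Scheme.Hom.ker_comp_of_isIso,
      specIdeal_ker]
    exact Ideal.mk_ker
  have hA : Algebra.Smooth ℤ A := smooth_of_smooth_spec (j ≫ s) inferInstance
  have hAI : Algebra.Smooth ℤ (A ⧸ I) :=
    smooth_of_smooth_spec (A := .of (A ⧸ I)) (e.inv ≫ pullback.snd j i ≫ i ≫ s) inferInstance
  -- If the ideal is killed, the point lies on `Z`. Otherwise `Spec T` maps to the blowup by its
  -- universal property, and the point factors through `Spec T`.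
  refine (exists_principal_factorization_of_smooth (k := ℤ) hR I α.hom).imp (fun hα => ?_) ?_
  · refine ⟨Spec.map (CommRingCat.ofHom (Ideal.Quotient.lift I α.hom fun a ha =>
      RingHom.mem_ker.mp (hα ha))) ≫ e.inv ≫
      pullback.snd j i, ?_⟩
    rw [Category.assoc, Category.assoc, ← pullback.condition, he, Category.assoc,
      Iso.inv_hom_id_assoc, ← Category.assoc, ← Spec.map_comp, ← CommRingCat.ofHom_comp,
      Ideal.Quotient.lift_comp_mk, CommRingCat.ofHom_hom]
  · rintro ⟨T, _, β, γ, hγ, f, hf, hβ⟩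
    let β' : A ⟶ CommRingCat.of T := CommRingCat.ofHom β
    obtain ⟨g, hg, -⟩ := h.universal _ (Spec.map β' ≫ j) <|
      isEffectiveCartier_of_specIdeal_eq (f := f) hf <| by
        rw [Scheme.IdealSheafData.comap_comp, specIdeal_comap, hI]
        exact hβ
    refine ⟨Spec.map (CommRingCat.ofHom γ) ≫ g, ?_⟩
    rw [Category.assoc, hg, ← Category.assoc, ← Spec.map_comp, ← CommRingCat.ofHom_comp, hγ,
      CommRingCat.ofHom_hom]

theorem IsSmoothBlowupFamily.isChainCovering {X : SchZ} {E : PreZeroHypercover.{0} X}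
    (hE : IsSmoothBlowupFamily X E) : IsChainCovering E := by
  cases hE with
  | mk i b hZ hX h =>
    intro R _ hR x
    rcases h.exists_lift_of_smooth _ hX
      ((SchZ.w_left i).symm ▸ hZ) hR x with ⟨y, hy⟩ | ⟨y, hy⟩
    · exact ⟨false, y, hy⟩
    · exact ⟨true, y, hy⟩

theorem IsOriginBlowupFamily.isSmoothBlowupFamily {n : ℕ} {X : SchZ} {E : PreZeroHypercover.{0} X}
    (hE : IsOriginBlowupFamily n X E) : IsSmoothBlowupFamily X E := by
  obtain ⟨b, h⟩ := hE
  refine .mk (originZ n) b ?_ ?_ h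
  · exact (HasRingHomProperty.Spec_iff (P := @Smooth)).mpr
      (RingHom.smooth_algebraMap.mpr (inferInstance : Algebra.Smooth ℤ ℤ))
  · exact (HasRingHomProperty.Spec_iff (P := @Smooth)).mpr
      (RingHom.smooth_algebraMap.mpr ⟨inferInstance, inferInstance⟩)

theorem proposition4p3 (X : SchZ) (U : PreZeroHypercover.{w} X) :
    List.TFAE
      [ IsChainCovering U,
        IsRefinableBy (fun S E => IsZariskiCovering S E ∨ IsSmoothBlowupFamily S E) U,
        IsRefinableBy
          (fun S E => IsZariskiCovering S E ∨ ∃ n : ℕ, 2 ≤ n ∧ IsOriginBlowupFamily n S E) U,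
        IsRefinableBy (fun S E => IsZariskiCovering S E ∨ IsOriginBlowupFamily 2 S E) U ] := by
  tfae_have 1 → 4 := IsChainCovering.isRefinableBy (fun _ _ => .inl) (fun _ _ => .inr)
  tfae_have 4 → 3 := IsRefinableBy.mono fun _ _ h => h.imp_right fun h => ⟨2, le_rfl, h⟩
  tfae_have 3 → 2 := IsRefinableBy.mono fun _ _ h =>
    h.imp_right fun ⟨_, _, h⟩ => h.isSmoothBlowupFamily
  tfae_have 2 → 1 := IsChainCovering.of_isRefinableBy fun _ _ h =>
    h.elim IsZariskiCovering.isChainCovering IsSmoothBlowupFamily.isChainCovering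
  tfae_finish
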